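/- **Setting.** For every sample size $T$ we observe $X_t=\mu_t+e_t$, $1\le t\le T$, where $(e_s)_{-\infty<s<\infty}$ are random variables with $Ee_s=0$, and where the means $\mu_t=\mu_{T,t}$ may depend on $T$ and change exactly once: $\mu_1=\dots=\mu_{t^*}\ne\mu_{t^*+1}=\dots=\mu_T$ with $1<t^*<T$ (for all large $T$). Both $t^*=t^*_T$ and $\Delta=\Delta_T=\mu_{t^*+1}-\mu_{t^*}$ may depend on $T$. Put $$A_T=\frac1{T^{1/2}}\max_{1\le t\le T}\Big|\sum_{s=1}^tX_s-\frac tT\sum_{s=1}^TX_s\Big|,\qquad D_T=\max_{t_T\le t\le T-t_T}\Big|\frac1t\sum_{s=1}^tX_s-\frac1{T-t}\sum_{s=t+1}^TX_s\Big|,$$ where $t_T$ is a sequence of positive integers (for large $T$). **Approximation assumption.** For some $\sigma>0$ and $0<\kappa<1/2$ there are, for each $T$, independent standard Wiener processes $\{W_{T,1}(x),0\le x\le T/2\}$ and $\{W_{T,2}(x),0\le x\le T/2\}$ such that, as $T\to\infty$, $$\sup_{1\le x\le T/2}x^{-\kappa}\Big|\sum_{s=1}^{\lfloor x\rfloor}e_s-\sigma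 W_{T,1}(x)\Big|=O_P(1),\qquad \sup_{T/2\le x\le T-1}(T-x)^{-\kappa}\Big|\sum_{s=\lfloor x\rfloor+1}^{T}e_s-\sigma W_{T,2}(T-x)\Big|=O_P(1).$$ **Theorem 4.2.** Suppose that the approximation assumption holds and that the change is early, $t^*/T\to0$ as $T\to\infty$. (i) If $(e_s)$ is (strictly) stationary, if there are $\bar\nu>2$ and $C$ with $E\big|\sum_{s=u}^ve_s\big|^{\bar\nu}\le C(v-u+1)^{\bar\nu/2}$ for all $1\le u\le v$, and if $t^*\to\infty$ and $|\Delta|(t^*)^{3/2}/T\to\infty$, then $$\Big(\frac T{t^*}\Big)^{1/2}\Big(A_T-T^{-3/2}t^*(T-t^*)|\Delta|\Big)\xrightarrow{\ \mathcal D\ }\sigma\mathcal N,$$ where $\mathcal N$ is a standard normal random variable. (ii) If $t_T\to\infty$, $t_T/T\to0$, $t^*/t_T\to\infty$, $t_T^{1/2}t^*|\Delta|/T\to0$ and $t_T^{1/2}|\Delta|\to\infty$, then $$t_T^{1/2}\big(D_T-|\Delta|\big)\xrightarrow{\ \mathcal D\ }\sigma\sup_{0\le u\le1}W(u),$$ where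 $W$ is a standard Wiener process. -/

import Mathlib

open MeasureTheory ProbabilityTheory Filter Topology
open scoped NNReal ENNReal

namespace RenyiCP

/-- `W` is a standard Wiener process on the time interval `[0, a]`: its finite-dimensional laws at
times in `[0, a]` are those of Brownian motion, and almost all its paths are continuous
on `[0, a]`. (Only the restriction of `W` to `[0, a]` matters.) -/
structure IsWienerOn {Ω : Type*} [MeasurableSpace Ω] (P : Measure Ω) (a : ℝ≥0)
    (W : ℝ≥0 → Ω → ℝ) : Prop where
  hasLaw : ∀ I : Finset ℝ≥0, (∀ x ∈ I, x ≤ a) →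
    HasLaw (fun ω ↦ I.restrict (W · ω)) (BrownianReal.projectiveFamily I) P
  continuousOn : ∀ᵐ ω ∂P, ContinuousOn (W · ω) (Set.Icc 0 a)

/-- `Y_T = O_P(1)` as `T → ∞`, for random variables with values in `[0, ∞]`. -/
def BoundedInProb {Ω : Type*} [MeasurableSpace Ω] (P : Measure Ω) (Y : ℕ → Ω → ℝ≥0∞) : Prop :=
  ∀ ε : ℝ≥0∞, 0 < ε → ∃ M : ℝ≥0, ∀ᶠ T in atTop, P {ω | (M : ℝ≥0∞) < Y T ω} ≤ ε

/-- The supremum over real `x ∈ [1, T/2]` of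
`x ^ (-κ) * |∑_{1 ≤ s ≤ ⌊x⌋} e_s - σ W(x)|`. -/
noncomputable def headError {Ω : Type*} (e : ℤ → Ω → ℝ) (σ κ : ℝ) (W : ℝ≥0 → Ω → ℝ)
    (T : ℕ) (ω : Ω) : ℝ≥0∞ :=
  ⨆ x ∈ Set.Icc (1 : ℝ≥0) ((T : ℝ≥0) / 2),
    ENNReal.ofReal ((x : ℝ) ^ (-κ) * |∑ s ∈ Finset.Icc 1 ⌊x⌋₊, e (s : ℤ) ω - σ * W x ω|)

/-- The supremum over real `x ∈ [T/2, T - 1]` of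
`(T - x) ^ (-κ) * |∑_{⌊x⌋ + 1 ≤ s ≤ T} e_s - σ W(T - x)|`. -/
noncomputable def tailError {Ω : Type*} (e : ℤ → Ω → ℝ) (σ κ : ℝ) (W : ℝ≥0 → Ω → ℝ)
    (T : ℕ) (ω : Ω) : ℝ≥0∞ :=
  ⨆ x ∈ Set.Icc ((T : ℝ≥0) / 2) ((T : ℝ≥0) - 1),
    ENNReal.ofReal (((T : ℝ) - (x : ℝ)) ^ (-κ) *
      |∑ s ∈ Finset.Icc (⌊x⌋₊ + 1) T, e (s : ℤ) ω - σ * W ((T : ℝ≥0) - x) ω|)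

/-- Gaussian approximation of the partial sums of the errors, with long run standard
deviation `σ > 0`: for every `T` there are independent Wiener processes `W₁ T`, `W₂ T` on
`[0, T/2]` that approximate the partial sums from the left and from the right end of the sample
at a rate `κ < 1/2`. -/
def GaussianApprox {Ω : Type*} [MeasurableSpace Ω] (P : Measure Ω) (e : ℤ → Ω → ℝ)
    (σ : ℝ) : Prop :=
  0 < σ ∧ ∃ κ : ℝ, 0 < κ ∧ κ < 1 / 2 ∧ ∃ W₁ W₂ : ℕ → ℝ≥0 → Ω → ℝ,
    (∀ T : ℕ, IsWienerOn P ((T : ℝ≥0) / 2) (W₁ T) ∧ IsWienerOn P ((T : ℝ≥0) / 2) (W₂ T) ∧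
      IndepFun (fun ω (x : Set.Icc (0 : ℝ≥0) ((T : ℝ≥0) / 2)) ↦ W₁ T x ω)
        (fun ω (x : Set.Icc (0 : ℝ≥0) ((T : ℝ≥0) / 2)) ↦ W₂ T x ω) P) ∧
    BoundedInProb P (fun T ↦ headError e σ κ (W₁ T) T) ∧
    BoundedInProb P (fun T ↦ tailError e σ κ (W₂ T) T)

/-- Strict stationarity: the law of the whole sequence is invariant under time shifts. -/
def IsStationary {Ω : Type*} [MeasurableSpace Ω] (P : Measure Ω) (e : ℤ → Ω → ℝ) : Prop :=
  ∀ h : ℤ, IdentDistrib (fun ω (s : ℤ) ↦ e (s + h) ω) (fun ω (s : ℤ) ↦ e s ω) P P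

/-- There are `ν > 2` and `C` with `E |e_u + ... + e_v| ^ ν ≤ C (v - u + 1) ^ (ν / 2)` for all
`1 ≤ u ≤ v`. -/
def MomentBound {Ω : Type*} [MeasurableSpace Ω] (P : Measure Ω) (e : ℤ → Ω → ℝ) : Prop :=
  ∃ ν C : ℝ, 2 < ν ∧ ∀ u v : ℕ, 1 ≤ u → u ≤ v →
    ∫⁻ ω, ENNReal.ofReal (|∑ s ∈ Finset.Icc u v, e (s : ℤ) ω| ^ ν) ∂P
      ≤ ENNReal.ofReal (C * ((v : ℝ) - (u : ℝ) + 1) ^ (ν / 2))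

/-- Exactly one change in the mean: for all large sample sizes `T`, the means `μ T 1, ..., μ T T`
are constant up to time `tstar T` and constant, with a different value, from time `tstar T + 1`
on, where `1 < tstar T < T`. -/
def OneChange (μ : ℕ → ℕ → ℝ) (tstar : ℕ → ℕ) : Prop :=
  ∀ᶠ T in atTop, 1 < tstar T ∧ tstar T < T ∧
    (∀ s, 1 ≤ s → s ≤ tstar T → μ T s = μ T (tstar T)) ∧
    (∀ s, tstar T + 1 ≤ s → s ≤ T → μ T s = μ T (tstar T + 1)) ∧
    μ T (tstar T) ≠ μ T (tstar T + 1)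

/-- The size `Δ_T` of the change. -/
def changeSize (μ : ℕ → ℕ → ℝ) (tstar : ℕ → ℕ) (T : ℕ) : ℝ :=
  μ T (tstar T + 1) - μ T (tstar T)

/-- The observations `X_t = μ_t + e_t` of the sample of size `T`. -/
def obs {Ω : Type*} (μ : ℕ → ℕ → ℝ) (e : ℤ → Ω → ℝ) (T : ℕ) (ω : Ω) (t : ℕ) : ℝ :=
  μ T t + e (t : ℤ) ω

/-- The maximally selected CUSUM statistic `A_T` of `x 1, ..., x T`. -/
noncomputable def cusumStat (x : ℕ → ℝ) (T : ℕ) : ℝ :=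
  1 / √(T : ℝ) * ⨆ t : Finset.Icc 1 T,
    |∑ s ∈ Finset.Icc 1 (t : ℕ), x s - ((t : ℕ) : ℝ) / (T : ℝ) * ∑ s ∈ Finset.Icc 1 T, x s|

/-- The Rényi statistic `D_T` of `x 1, ..., x T` with trimming parameter `m`: the maximum over
`m ≤ t ≤ T - m` of the distance between the mean of the first `t` and the mean of the last `T - t`
observations. -/
noncomputable def renyiStat (x : ℕ → ℝ) (T m : ℕ) : ℝ :=
  ⨆ t : Finset.Icc m (T - m),
    |1 / ((t : ℕ) : ℝ) * ∑ s ∈ Finset.Icc 1 (t : ℕ), x s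
      - 1 / ((T : ℝ) - ((t : ℕ) : ℝ)) * ∑ s ∈ Finset.Icc ((t : ℕ) + 1) T, x s|

end RenyiCP

/-! Each statistic is a maximum of |noise - Δ * drift|, with a drift that depends only on `T`, the
change point `n = t*` and `t`. On events of probability tending to one (`WHP`), deterministic
inequalities compare the statistic with a functional of the Wiener process `W₁ T` whose law is
explicit; `tendstoInDistribution_of_eventually_identDistrib` then gives the limit.

CUSUM: the drift is a tent with its peak at `n`, falling to the right with slope `n / T`. If the
noise moves away from its value at `n` by at most `c √n` plus half of the drift lost, the maximum is
the value at the peak up to a multiple of `c √n` (`abs_iSup_abs_sub_le`, `abs_iSup_cusum_le`).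
Divided by `√n`, what remains is `± σ W₁(n) / √n`, which is exactly `N(0, σ²)`. The noise is
controlled by the line-crossing bound `IsGaussianWalk.measure_exists_le`: a walk crosses `a + δ k`
with probability at most `exp (-2 δ a)`. With `a` of order `√n` and `δ` of order `|Δ| n / T`, the
exponent is of order `|Δ| n ^ (3/2) / T`, which diverges by assumption.

Rényi, with trimming `m`: on `[m, n]` the drift is so close to one that its loss, scaled by `√m
|Δ|`, vanishes. From `n` to `T / 2` the scaled noise vanishes because `n / m → ∞`, and beyond `T /
2` the drift is at most one half, which the diverging `√m |Δ|` turns into a prohibitive loss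
(`abs_iSup_renyi_le`). There remains the maximum of `∓ σ √m W₁(k) / k` over `[m, n]`. By time
inversion it has the law of `σ` times the maximum of a Wiener process over the points `m / k`
(`identDistrib_iSup_grid`), and these fill `[0, 1]` (`tendsto_iSup_grid`). -/

namespace RenyiCP

/-! ### Marginals and covariances of a Wiener process. -/

section Wiener

variable {Ω : Type*} [MeasurableSpace Ω] {P : Measure Ω} {a : ℝ≥0} {W : ℝ≥0 → Ω → ℝ}

/-- The times may repeat, so the vector is a linear image of the process restricted to the finite
set of their values. -/
lemma IsWienerOn.hasGaussianLaw (h : IsWienerOn P a W) {ι : Type*} [Fintype ι] (u : ι → ℝ≥0)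
    (hu : ∀ i, u i ≤ a) : HasGaussianLaw (fun ω i ↦ W (u i) ω) P := by
  classical
  have hI : ∀ x ∈ Finset.univ.image u, x ≤ a := by simpa using hu
  exact (h.hasLaw _ hI).hasGaussianLaw.map_fun
    (ContinuousLinearMap.pi fun i ↦
      ContinuousLinearMap.proj (R := ℝ) (φ := fun _ : Finset.univ.image u ↦ ℝ) ⟨u i, by simp⟩)

lemma IsWienerOn.hasGaussianLaw_eval (h : IsWienerOn P a W) {x : ℝ≥0} (hx : x ≤ a) :
    HasGaussianLaw (W x) P :=
  (h.hasGaussianLaw (fun _ : Unit ↦ x) fun _ ↦ hx).map_fun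
    (ContinuousLinearMap.proj (R := ℝ) (φ := fun _ : Unit ↦ ℝ) ())

lemma IsWienerOn.hasLaw_eval (h : IsWienerOn P a W) {x : ℝ≥0} (hx : x ≤ a) :
    HasLaw (W x) (gaussianReal 0 x) P :=
  (BrownianReal.measurePreserving_eval_projectiveFamily ⟨x, by simp⟩).hasLaw.comp
    (h.hasLaw {x} (by simpa using hx))

lemma IsWienerOn.integral_eval (h : IsWienerOn P a W) {x : ℝ≥0} (hx : x ≤ a) :
    ∫ ω, W x ω ∂P = 0 := by
  rw [(h.hasLaw_eval hx).integral_eq, integral_id_gaussianReal]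

lemma IsWienerOn.covariance_eval (h : IsWienerOn P a W) {s t : ℝ≥0} (hs : s ≤ a) (ht : t ≤ a) :
    cov[W s, W t; P] = min s t := by
  have hI : ∀ x ∈ ({s, t} : Finset ℝ≥0), x ≤ a := by simp [hs, ht]
  have h1 := (h.hasLaw {s, t} hI).covariance_fun_comp
    (f := fun x ↦ x ⟨s, by simp⟩) (g := fun x ↦ x ⟨t, by simp⟩)
    (measurable_pi_apply _).aemeasurable (measurable_pi_apply _).aemeasurable
  rw [BrownianReal.covariance_eval_projectiveFamily] at h1
  exact h1

/-- Chebyshev's inequality with variance `x`; it is precise enough for bounds at a single time. -/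
lemma IsWienerOn.measure_le_abs (h : IsWienerOn P a W) {x : ℝ≥0} (hx : x ≤ a) {c : ℝ}
    (hc : 0 < c) : P {ω | c ≤ |W x ω|} ≤ ENNReal.ofReal (x / c ^ 2) := by
  have hg := h.hasGaussianLaw_eval hx
  have := hg.isProbabilityMeasure
  have h1 := meas_ge_le_variance_div_sq hg.memLp_two hc
  have h2 : Var[W x; P] = x := by
    rw [(h.hasLaw_eval hx).variance_eq, variance_id_gaussianReal]
  simpa [h.integral_eval hx, h2] using h1

end Wiener

/-! ### Gaussian vectors are determined by their covariances. -/

section IdentDistrib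

/-- Two centred Gaussian vectors with the same covariances have the same law. -/
lemma identDistrib_of_covariance_eq {Ω Ω' : Type*} [MeasurableSpace Ω] [MeasurableSpace Ω']
    {P : Measure Ω} {P' : Measure Ω'} {ι : Type*} [Fintype ι] {X : ι → Ω → ℝ} {Y : ι → Ω' → ℝ}
    (hX : HasGaussianLaw (fun ω i ↦ X i ω) P) (hY : HasGaussianLaw (fun ω i ↦ Y i ω) P')
    (hX0 : ∀ i, ∫ ω, X i ω ∂P = 0) (hY0 : ∀ i, ∫ ω, Y i ω ∂P' = 0)
    (hXY : ∀ i j, cov[X i, X j; P] = cov[Y i, Y j; P']) :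
    IdentDistrib (fun ω i ↦ X i ω) (fun ω i ↦ Y i ω) P P' := by
  classical
  have := hX.isProbabilityMeasure
  have := hY.isProbabilityMeasure
  refine ⟨hX.aemeasurable, hY.aemeasurable, ?_⟩
  apply Measure.ext_of_charFunDual
  ext L
  rw [hX.charFunDual_map_eq_fun, hY.charFunDual_map_eq_fun]
  -- A linear form is given by weights, so its mean and variance, which determine the characteristic
  -- function, depend only on means and covariances.
  obtain ⟨w, hL⟩ : ∃ w : ι → ℝ, ∀ y : ι → ℝ, L y = ∑ i, w i * y i := by
    refine ⟨fun i ↦ L (Pi.single i 1), fun y ↦ ?_⟩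
    conv_lhs => rw [← Finset.univ_sum_single y, map_sum]
    refine Finset.sum_congr rfl fun i _ ↦ ?_
    rw [mul_comm, ← smul_eq_mul, ← map_smul, ← Pi.single_smul]
    rw [smul_eq_mul, mul_one]
  have hXi i : HasGaussianLaw (X i) P :=
    hX.map_fun (ContinuousLinearMap.proj (R := ℝ) (φ := fun _ : ι ↦ ℝ) i)
  have hYi i : HasGaussianLaw (Y i) P' :=
    hY.map_fun (ContinuousLinearMap.proj (R := ℝ) (φ := fun _ : ι ↦ ℝ) i)
  simp_rw [hL]
  rw [integral_finsetSum _ fun i _ ↦ (hXi i).integrable.const_mul _,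
    integral_finsetSum _ fun i _ ↦ (hYi i).integrable.const_mul _,
    variance_fun_sum fun i ↦ (hXi i).memLp_two.const_mul _,
    variance_fun_sum fun i ↦ (hYi i).memLp_two.const_mul _]
  simp_rw [integral_const_mul, hX0, hY0, covariance_const_mul_left, covariance_const_mul_right, hXY]

end IdentDistrib

/-! ### Gaussian random walks and the line-crossing inequality. -/

section Walk

variable {Ω : Type*} [MeasurableSpace Ω] {P : Measure Ω}

/-- `Z 0, ..., Z n` is a centred Gaussian vector with the covariances of a random walk with
standard normal increments. -/
structure IsGaussianWalk (P : Measure Ω) (n : ℕ) (Z : ℕ → Ω → ℝ) : Prop where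
  gaussian : HasGaussianLaw (fun ω (k : Fin (n + 1)) ↦ Z k ω) P
  integral_eq : ∀ k ≤ n, ∫ ω, Z k ω ∂P = 0
  covariance_eq : ∀ j k, j ≤ k → k ≤ n → cov[Z j, Z k; P] = j

variable {n : ℕ} {Z : ℕ → Ω → ℝ}

lemma IsGaussianWalk.hasGaussianLaw_eval (h : IsGaussianWalk P n Z) {k : ℕ} (hk : k ≤ n) :
    HasGaussianLaw (Z k) P :=
  h.gaussian.map_fun (ContinuousLinearMap.proj (R := ℝ) (φ := fun _ : Fin (n + 1) ↦ ℝ)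
    ⟨k, by omega⟩)

lemma IsGaussianWalk.covariance_self (h : IsGaussianWalk P n Z) {k : ℕ} (hk : k ≤ n) :
    cov[Z k, Z k; P] = k := h.covariance_eq k k le_rfl hk

lemma IsGaussianWalk.neg (h : IsGaussianWalk P n Z) :
    IsGaussianWalk P n (fun k ω ↦ -Z k ω) where
  gaussian := h.gaussian.fun_neg
  integral_eq k hk := by rw [integral_neg, h.integral_eq k hk, neg_zero]
  covariance_eq j k hjk hk := by
    rw [covariance_fun_neg_left, covariance_fun_neg_right, neg_neg]
    exact h.covariance_eq j k hjk hk

lemma IsGaussianWalk.map_sub (h : IsGaussianWalk P n Z) {k : ℕ} (hk : k ≤ n) :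
    P.map (fun ω ↦ Z n ω - Z k ω) = gaussianReal 0 (n - k : ℕ) := by
  have hn := h.hasGaussianLaw_eval le_rfl
  have hk' := h.hasGaussianLaw_eval hk
  have := hn.isProbabilityMeasure
  have hg : HasGaussianLaw (fun ω ↦ Z n ω - Z k ω) P :=
    h.gaussian.map_fun (ContinuousLinearMap.proj (R := ℝ) (φ := fun _ : Fin (n + 1) ↦ ℝ)
      ⟨n, by omega⟩ - ContinuousLinearMap.proj (R := ℝ) (φ := fun _ : Fin (n + 1) ↦ ℝ)
      ⟨k, by omega⟩)
  rw [hg.map_eq_gaussianReal, integral_sub hn.integrable hk'.integrable, h.integral_eq n le_rfl,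
    h.integral_eq k hk, variance_fun_sub hn.memLp_two hk'.memLp_two,
    ← ProbabilityTheory.covariance_self hn.aemeasurable,
    ← ProbabilityTheory.covariance_self hk'.aemeasurable, h.covariance_self le_rfl,
    h.covariance_self hk, covariance_comm, h.covariance_eq k n hk le_rfl]
  congr 1
  · simp
  · rw [← NNReal.coe_inj, Real.coe_toNNReal]
    · rw [NNReal.coe_natCast, Nat.cast_sub hk]; ring
    · have : (k : ℝ) ≤ n := by exact_mod_cast hk
      linarith

/-- The normalisation of the exponential martingale, from the Gaussian moment generating function.
-/
lemma lintegral_exp_gaussianReal {X : Ω → ℝ} (hX : AEMeasurable X P) {v : ℝ≥0}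
    (h : P.map X = gaussianReal 0 v) (l : ℝ) :
    ∫⁻ ω, ENNReal.ofReal (Real.exp (l * X ω - l ^ 2 * v / 2)) ∂P = 1 := by
  have h1 := mgf_gaussianReal h l
  have h2 : Integrable (fun ω ↦ Real.exp (l * X ω)) P := by
    have := (integrable_exp_mul_gaussianReal (μ := 0) (v := v) l)
    rw [← h] at this
    exact (integrable_map_measure (by fun_prop) hX).1 this
  simp_rw [Real.exp_sub]
  rw [← ofReal_integral_eq_lintegral_ofReal (h2.div_const _)
    (ae_of_all _ fun ω ↦ by positivity), integral_div]
  rw [mgf] at h1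
  rw [h1]
  simp only [zero_mul, zero_add]
  rw [mul_comm (v : ℝ), div_self (Real.exp_pos _).ne', ENNReal.ofReal_one]

/-- Past and later increment are jointly Gaussian, and uncorrelated since `cov(Z j, Z n) = cov(Z j,
Z k) = j`. -/
lemma IsGaussianWalk.indepFun (h : IsGaussianWalk P n Z) {k : ℕ} (hk : k ≤ n) :
    IndepFun (fun ω (j : Fin (k + 1)) ↦ Z j ω) (fun ω (_ : Unit) ↦ Z n ω - Z k ω) P := by
  have := h.gaussian.isProbabilityMeasure
  refine HasGaussianLaw.indepFun_of_covariance_eval (X := fun (j : Fin (k + 1)) ω ↦ Z j ω)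
    (Y := fun (_ : Unit) ω ↦ Z n ω - Z k ω) ?_ fun j _ ↦ ?_
  · exact h.gaussian.map_fun ((ContinuousLinearMap.pi fun j : Fin (k + 1) ↦
      ContinuousLinearMap.proj (R := ℝ) (φ := fun _ : Fin (n + 1) ↦ ℝ) ⟨j, by omega⟩).prod
      (ContinuousLinearMap.pi fun _ : Unit ↦
        ContinuousLinearMap.proj (R := ℝ) (φ := fun _ : Fin (n + 1) ↦ ℝ) ⟨n, by omega⟩ -
        ContinuousLinearMap.proj (R := ℝ) (φ := fun _ : Fin (n + 1) ↦ ℝ) ⟨k, by omega⟩))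
  · have hj : (j : ℕ) ≤ k := by omega
    rw [covariance_fun_sub_right (h.hasGaussianLaw_eval (hj.trans hk)).memLp_two
      (h.hasGaussianLaw_eval le_rfl).memLp_two (h.hasGaussianLaw_eval hk).memLp_two]
    have h1 := h.covariance_eq j n (hj.trans hk) le_rfl
    have h2 := h.covariance_eq j k hj hk
    linarith

/-- Exponential line-crossing inequality for a Gaussian random walk. -/
theorem IsGaussianWalk.measure_exists_le (h : IsGaussianWalk P n Z) {a δ : ℝ} (hδ : 0 ≤ δ) :
    P {ω | ∃ k ≤ n, a + δ * k ≤ Z k ω} ≤ ENNReal.ofReal (Real.exp (-(2 * δ * a))) := by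
  classical
  -- With this exponent, the exponential martingale `M k` is at least `exp (l * a)` on the line `a +
  -- δ k`, whatever `k` is.
  set l : ℝ := 2 * δ
  set M : ℕ → Ω → ℝ≥0∞ := fun k ω ↦ ENNReal.ofReal (Real.exp (l * Z k ω - l ^ 2 * k / 2))
  -- First passage at time `k`. These events are disjoint and depend only on the past up to `k`, so
  -- `M k` may be replaced by `M n` in the integral over `A k`: optional stopping done by hand.
  set A : ℕ → Set Ω := fun k ↦ {ω | a + δ * k ≤ Z k ω ∧ ∀ j < k, Z j ω < a + δ * j}
  have key : ∀ k ≤ n, P (A k) * ENNReal.ofReal (Real.exp (l * a)) ≤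
      ∫⁻ ω, (A k).indicator (M n) ω ∂P := by
    intro k hk
    set B : Set (Fin (k + 1) → ℝ) :=
      {y | a + δ * k ≤ y (Fin.last k) ∧ ∀ j, j < Fin.last k → y j < a + δ * (j : ℕ)}
    have hB : MeasurableSet B := by
      have : B = {y | a + δ * k ≤ y (Fin.last k)} ∩
          ⋂ j, ⋂ (_ : j < Fin.last k), {y | y j < a + δ * (j : ℕ)} := by ext; simp [B]
      rw [this]
      exact (measurableSet_le measurable_const (measurable_pi_apply _)).inter
        (.iInter fun j ↦ .iInter fun _ ↦
          measurableSet_lt (measurable_pi_apply _) measurable_const)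
    set φ : (Fin (k + 1) → ℝ) → ℝ≥0∞ :=
      B.indicator
        fun y ↦ ENNReal.ofReal (Real.exp (l * y (Fin.last k) - l ^ 2 * k / 2))
    have hφ : Measurable φ := by
      exact Measurable.indicator (by fun_prop) hB
    have hmem : ∀ ω, (fun j : Fin (k + 1) ↦ Z j ω) ∈ B ↔ ω ∈ A k := by
      intro ω
      simp only [Set.mem_ofPred_eq, Fin.val_last, A, B]
      refine and_congr_right fun _ ↦ ⟨fun H j hj ↦ H ⟨j, by omega⟩ ?_, fun H j hj ↦ H j ?_⟩
      · simpa [Fin.lt_def] using hj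
      · simpa [Fin.lt_def] using hj
    have hφA : ∀ ω, φ (fun j ↦ Z j ω) = (A k).indicator (M k) ω := by
      intro ω
      by_cases hω : ω ∈ A k
      · rw [Set.indicator_of_mem hω]
        exact Set.indicator_of_mem ((hmem ω).2 hω) _
      · rw [Set.indicator_of_notMem hω]
        exact Set.indicator_of_notMem (mt (hmem ω).1 hω) _
    set ψ : (Unit → ℝ) → ℝ≥0∞ :=
      fun y ↦ ENNReal.ofReal (Real.exp (l * y () - l ^ 2 * ((n - k : ℕ) : ℝ≥0) / 2))
    have hψ : Measurable ψ := by fun_prop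
    have hψ1 : ∫⁻ ω, ψ (fun _ ↦ Z n ω - Z k ω) ∂P = 1 :=
      lintegral_exp_gaussianReal ((h.hasGaussianLaw_eval le_rfl).aemeasurable.sub
        (h.hasGaussianLaw_eval hk).aemeasurable) (h.map_sub hk) l
    have hpast : AEMeasurable (fun ω (j : Fin (k + 1)) ↦ Z j ω) P :=
      aemeasurable_pi_lambda _ fun j ↦ (h.hasGaussianLaw_eval (by omega)).aemeasurable
    have hfut : AEMeasurable (fun ω (_ : Unit) ↦ Z n ω - Z k ω) P :=
      aemeasurable_pi_lambda _ fun _ ↦ (h.hasGaussianLaw_eval le_rfl).aemeasurable.sub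
        (h.hasGaussianLaw_eval hk).aemeasurable
    have hprod := lintegral_mul_eq_lintegral_mul_lintegral_of_indepFun''
      (hφ.comp_aemeasurable hpast) (hψ.comp_aemeasurable hfut) ((h.indepFun hk).comp hφ hψ)
    have hψ1' : ∫⁻ ω, (ψ ∘ fun ω (_ : Unit) ↦ Z n ω - Z k ω) ω ∂P = 1 := hψ1
    rw [hψ1', mul_one] at hprod
    have hMn : ∀ ω, (A k).indicator (M n) ω =
        φ (fun j ↦ Z j ω) * ψ (fun _ ↦ Z n ω - Z k ω) := by
      intro ω
      rw [hφA]
      by_cases hω : ω ∈ A k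
      · rw [Set.indicator_of_mem hω, Set.indicator_of_mem hω]
        simp only [M, ψ]
        rw [← ENNReal.ofReal_mul (by positivity), ← Real.exp_add]
        congr 2
        rw [NNReal.coe_natCast, Nat.cast_sub hk]
        ring
      · rw [Set.indicator_of_notMem hω, Set.indicator_of_notMem hω, zero_mul]
    simp_rw [hMn]
    refine le_trans ?_ hprod.ge
    have hnull : NullMeasurableSet (A k) P := by
      have : A k = (fun ω (j : Fin (k + 1)) ↦ Z j ω) ⁻¹' B := by
        ext ω; exact (hmem ω).symm
      rw [this]
      exact hpast.nullMeasurableSet_preimage hB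
    rw [mul_comm, ← lintegral_indicator_const₀ hnull]
    refine lintegral_mono fun ω ↦ ?_
    simp only [Function.comp_apply]
    rw [hφA]
    by_cases hω : ω ∉ A k
    · simp [hω]
    rw [not_not] at hω
    rw [Set.indicator_of_mem hω, Set.indicator_of_mem hω]
    refine ENNReal.ofReal_le_ofReal (Real.exp_le_exp.2 ?_)
    have h1 : a + δ * k ≤ Z k ω := hω.1
    have h2 : l * (a + δ * k) ≤ l * Z k ω := mul_le_mul_of_nonneg_left h1 (by positivity)
    simp only [l] at h2 ⊢
    nlinarith
  have hcover : {ω | ∃ k ≤ n, a + δ * k ≤ Z k ω} ⊆ ⋃ k ∈ Finset.range (n + 1), A k := by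
    rintro ω ⟨k, hk, hω⟩
    have hex : ∃ k, a + δ * k ≤ Z k ω := ⟨k, hω⟩
    simp only [Finset.mem_range, Set.mem_iUnion]
    refine ⟨Nat.find hex, ?_, Nat.find_spec hex, fun j hj ↦ not_le.1 (Nat.find_min hex hj)⟩
    have := Nat.find_min' hex hω
    omega
  have hMn : ∫⁻ ω, M n ω ∂P = 1 := by
    have := h.gaussian.isProbabilityMeasure
    have hg := h.hasGaussianLaw_eval le_rfl
    refine lintegral_exp_gaussianReal (v := n) hg.aemeasurable ?_ l
    rw [hg.map_eq_gaussianReal, h.integral_eq n le_rfl,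
      ← ProbabilityTheory.covariance_self hg.aemeasurable, h.covariance_self le_rfl]
    simp
  have hsum : P {ω | ∃ k ≤ n, a + δ * k ≤ Z k ω} * ENNReal.ofReal (Real.exp (l * a)) ≤ 1 := by
    calc P {ω | ∃ k ≤ n, a + δ * k ≤ Z k ω} * ENNReal.ofReal (Real.exp (l * a))
        ≤ (∑ k ∈ Finset.range (n + 1), P (A k)) * ENNReal.ofReal (Real.exp (l * a)) := by
          gcongr
          exact (measure_mono hcover).trans (measure_biUnion_finset_le _ _)
      _ ≤ ∑ k ∈ Finset.range (n + 1), ∫⁻ ω, (A k).indicator (M n) ω ∂P := by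
          rw [Finset.sum_mul]
          exact Finset.sum_le_sum fun k hk ↦ key k (by simpa [Nat.lt_succ_iff] using hk)
      _ ≤ ∫⁻ ω, ∑ k ∈ Finset.range (n + 1), (A k).indicator (M n) ω ∂P := by
          induction Finset.range (n + 1) using Finset.induction_on with
          | empty => simp
          | insert k s hks ih =>
            simp only [Finset.sum_insert hks]
            exact (add_le_add_right ih _).trans (le_lintegral_add _ _)
      -- By disjointness at most one indicator is nonzero.
      _ ≤ ∫⁻ ω, M n ω ∂P := by
          refine lintegral_mono fun ω ↦ ?_
          by_cases hω : ∃ k ∈ Finset.range (n + 1), ω ∈ A k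
          · obtain ⟨k, hk, hkω⟩ := hω
            rw [Finset.sum_eq_single_of_mem k hk]
            · exact Set.indicator_le_self _ _ _
            · intro j _ hjk
              refine Set.indicator_of_notMem (fun hj ↦ ?_) _
              rcases lt_or_gt_of_ne hjk with hlt | hlt
              · exact absurd hj.1 (not_le.2 (hkω.2 j hlt))
              · exact absurd hkω.1 (not_le.2 (hj.2 k hlt))
          · push Not at hω
            rw [Finset.sum_eq_zero fun k hk ↦ Set.indicator_of_notMem (hω k hk) _]
            exact zero_le
      _ = 1 := hMn
  rw [Real.exp_neg, ENNReal.ofReal_inv_of_pos (Real.exp_pos _)]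
  exact ENNReal.le_inv_iff_mul_le.2 hsum

/-- Two-sided version of `IsGaussianWalk.measure_exists_le`. -/
theorem IsGaussianWalk.measure_exists_le_abs (h : IsGaussianWalk P n Z) {a δ : ℝ} (hδ : 0 ≤ δ) :
    P {ω | ∃ k ≤ n, a + δ * k ≤ |Z k ω|} ≤ 2 * ENNReal.ofReal (Real.exp (-(2 * δ * a))) := by
  have hsub : {ω | ∃ k ≤ n, a + δ * k ≤ |Z k ω|} ⊆
      {ω | ∃ k ≤ n, a + δ * k ≤ Z k ω} ∪ {ω | ∃ k ≤ n, a + δ * k ≤ -Z k ω} := by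
    rintro ω ⟨k, hk, hω⟩
    rcases le_abs.1 hω with h1 | h1
    exacts [Or.inl ⟨k, hk, h1⟩, Or.inr ⟨k, hk, h1⟩]
  refine (measure_mono hsub).trans ((measure_union_le _ _).trans ?_)
  rw [two_mul]
  exact add_le_add (h.measure_exists_le hδ) (h.neg.measure_exists_le hδ)

/-- Increments of a Wiener process, observed at suitable times, form a Gaussian random walk. -/
lemma IsWienerOn.isGaussianWalk {a : ℝ≥0} {W : ℝ≥0 → Ω → ℝ} (h : IsWienerOn P a W)
    {p : ℝ≥0} (hp : p ≤ a) {u : ℕ → ℝ≥0} (hu : ∀ k ≤ n, u k ≤ a)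
    (hcov : ∀ j k : ℕ, j ≤ k → k ≤ n →
      ((min (u j) (u k) : ℝ≥0) : ℝ) - (min (u j) p : ℝ≥0) - (min p (u k) : ℝ≥0) + p = j) :
    IsGaussianWalk P n (fun k ω ↦ W (u k) ω - W p ω) where
  gaussian := by
    have := h.hasGaussianLaw (fun k : Option (Fin (n + 1)) ↦ k.elim p fun i ↦ u i) (by
      rintro (_ | ⟨i, hi⟩)
      exacts [hp, hu i (by omega)])
    exact this.map_fun (ContinuousLinearMap.pi fun i : Fin (n + 1) ↦
      ContinuousLinearMap.proj (R := ℝ) (φ := fun _ : Option (Fin (n + 1)) ↦ ℝ) (some i) -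
      ContinuousLinearMap.proj (R := ℝ) (φ := fun _ : Option (Fin (n + 1)) ↦ ℝ) none)
  integral_eq k hk := by
    rw [integral_sub (h.hasGaussianLaw_eval (hu k hk)).integrable
      (h.hasGaussianLaw_eval hp).integrable, h.integral_eval (hu k hk), h.integral_eval hp,
      sub_zero]
  covariance_eq j k hjk hk := by
    have hj := h.hasGaussianLaw_eval (hu j (hjk.trans hk))
    have hk' := h.hasGaussianLaw_eval (hu k hk)
    have hp' := h.hasGaussianLaw_eval hp
    have := hj.isProbabilityMeasure
    rw [covariance_fun_sub_fun_sub hj.memLp_two hp'.memLp_two hk'.memLp_two hp'.memLp_two]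
    have e1 := h.covariance_eval (hu j (hjk.trans hk)) (hu k hk)
    have e2 := h.covariance_eval (hu j (hjk.trans hk)) hp
    have e3 := h.covariance_eval hp (hu k hk)
    have e4 := h.covariance_eval hp hp
    have := hcov j k hjk hk
    simp only [min_self] at e4
    push_cast at this e1 e2 e3
    linarith

end Walk

/-! ### Events with probability tending to one. -/

section WithHighProbability

variable {Ω : Type*} [MeasurableSpace Ω] {P : Measure Ω} {p q : ℕ → Ω → Prop}

/-- The probability of `p T` tends to one as `T → ∞`. -/
def WHP (P : Measure Ω) (p : ℕ → Ω → Prop) : Prop :=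
  Tendsto (fun T ↦ P {ω | ¬ p T ω}) atTop (𝓝 0)

lemma WHP.mono (hp : WHP P p) (h : ∀ᶠ T in atTop, ∀ ω, p T ω → q T ω) : WHP P q := by
  refine tendsto_of_tendsto_of_tendsto_of_le_of_le' tendsto_const_nhds hp
    (.of_forall fun _ ↦ zero_le) ?_
  filter_upwards [h] with T hT
  exact measure_mono fun ω hω hpω ↦ hω (hT ω hpω)

lemma WHP.and (hp : WHP P p) (hq : WHP P q) : WHP P (fun T ω ↦ p T ω ∧ q T ω) := by
  have := hp.add hq
  rw [add_zero] at this
  refine tendsto_of_tendsto_of_tendsto_of_le_of_le tendsto_const_nhds this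
    (fun _ ↦ zero_le) fun T ↦ ?_
  refine (measure_mono fun ω hω ↦ ?_).trans (measure_union_le _ _)
  by_cases h : p T ω
  exacts [Or.inr fun h' ↦ hω ⟨h, h'⟩, Or.inl h]

lemma WHP.of_le {f : ℕ → ℝ} (hf : Tendsto f atTop (𝓝 0))
    (h : ∀ᶠ T in atTop, P {ω | ¬ p T ω} ≤ ENNReal.ofReal (f T)) : WHP P p := by
  have := ENNReal.tendsto_ofReal hf
  rw [ENNReal.ofReal_zero] at this
  exact tendsto_of_tendsto_of_tendsto_of_le_of_le' tendsto_const_nhds this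
    (.of_forall fun _ ↦ zero_le) h

lemma BoundedInProb.whp {Y : ℕ → Ω → ℝ≥0∞} (hY : BoundedInProb P Y) {r : ℕ → ℝ}
    (hr : Tendsto r atTop atTop) : WHP P (fun T ω ↦ Y T ω ≤ ENNReal.ofReal (r T)) := by
  refine ENNReal.tendsto_nhds_zero.2 fun ε hε ↦ ?_
  obtain ⟨M, hM⟩ := hY ε hε
  filter_upwards [hM, hr.eventually_ge_atTop (M : ℝ)] with T hT hrT
  refine (measure_mono fun ω hω ↦ ?_).trans hT
  simp only [not_le, Set.mem_ofPred_eq] at hω ⊢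
  refine lt_of_le_of_lt ?_ hω
  rw [← ENNReal.ofReal_coe_nnreal]
  exact ENNReal.ofReal_le_ofReal hrT

/-- A sequence tending to infinity more slowly than three given ones. -/
lemma exists_tendsto_atTop_le_mul {a b c : ℕ → ℝ} (ha : Tendsto a atTop atTop)
    (hb : Tendsto b atTop atTop) (hc : Tendsto c atTop atTop) :
    ∃ r : ℕ → ℝ, Tendsto r atTop atTop ∧ ∀ ε : ℝ, 0 < ε → ∀ᶠ T in atTop,
      r T ≤ ε * a T ∧ r T ≤ ε * b T ∧ r T ≤ ε * c T := by
  set m : ℕ → ℝ := fun T ↦ min (a T) (min (b T) (c T))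
  have hm : Tendsto m atTop atTop := by
    refine tendsto_atTop.2 fun K ↦ ?_
    filter_upwards [ha.eventually_ge_atTop K, hb.eventually_ge_atTop K,
      hc.eventually_ge_atTop K] with T h1 h2 h3
    exact le_min h1 (le_min h2 h3)
  -- The square root of the smallest of the three is negligible against each of them.
  refine ⟨fun T ↦ √(m T), Real.tendsto_sqrt_atTop.comp hm, fun ε hε ↦ ?_⟩
  filter_upwards [hm.eventually_ge_atTop ((1 / ε) ^ 2)] with T hT
  have h0 : 0 ≤ m T := (sq_nonneg _).trans hT
  have h1 : 1 / ε ≤ √(m T) := Real.le_sqrt_of_sq_le hT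
  have h2 : √(m T) ≤ ε * m T := by
    have h3 : 1 ≤ ε * √(m T) := by
      rw [div_le_iff₀ hε] at h1; linarith
    calc √(m T) ≤ (ε * √(m T)) * √(m T) := le_mul_of_one_le_left (Real.sqrt_nonneg _) h3
      _ = ε * m T := by rw [mul_assoc, Real.mul_self_sqrt h0]
  exact ⟨h2.trans (by gcongr; exact min_le_left _ _),
    h2.trans (by gcongr; exact (min_le_right _ _).trans (min_le_left _ _)),
    h2.trans (by gcongr; exact (min_le_right _ _).trans (min_le_right _ _))⟩

end WithHighProbability

/-- If `Y` is close in probability to `X`, and `X T` has the same law as `U T` for large `T`, then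
`Y` inherits the limit in distribution of `U`. -/
lemma tendstoInDistribution_of_eventually_identDistrib {Ω Ω' Ω'' : Type*} [MeasurableSpace Ω]
    [MeasurableSpace Ω'] [MeasurableSpace Ω''] {P : Measure Ω} [IsProbabilityMeasure P]
    {P' : Measure Ω'} [IsProbabilityMeasure P'] {P'' : Measure Ω''} [IsProbabilityMeasure P'']
    {X Y : ℕ → Ω → ℝ} {U : ℕ → Ω' → ℝ} {Z : Ω'' → ℝ} (hY : ∀ T, AEMeasurable (Y T) P)
    (hU : TendstoInDistribution U atTop Z (fun _ ↦ P') P'')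
    (hX : ∀ᶠ T in atTop, IdentDistrib (X T) (U T) P P')
    (hXY : ∀ c : ℝ, 0 < c → WHP P (fun T ω ↦ |Y T ω - X T ω| ≤ c)) :
    TendstoInDistribution Y atTop Z (fun _ ↦ P) P'' := by
  classical
  -- Convergence in distribution asks for measurability at every `T`, while `X T` is known to be
  -- measurable only for large `T`.
  set X' : ℕ → Ω → ℝ := fun T ↦ if IdentDistrib (X T) (U T) P P' then X T else fun _ ↦ 0
  have hX'm : ∀ T, AEMeasurable (X' T) P := by
    intro T
    by_cases h : IdentDistrib (X T) (U T) P P'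
    · simp only [X', if_pos h]; exact h.aemeasurable_fst
    · simp only [X', if_neg h]; exact aemeasurable_const
  have hX' : ∀ᶠ T in atTop, X' T = X T ∧ IdentDistrib (X T) (U T) P P' := by
    filter_upwards [hX] with T hT
    exact ⟨if_pos hT, hT⟩
  have hXZ : TendstoInDistribution X' atTop Z (fun _ ↦ P) P'' := by
    refine ⟨hX'm, hU.aemeasurable_limit, hU.tendsto.congr' ?_⟩
    filter_upwards [hX'] with T hT
    refine Subtype.ext ?_
    change P'.map (U T) = P.map (X' T)
    rw [hT.1]
    exact hT.2.map_eq.symm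
  refine tendstoInDistribution_of_tendstoInMeasure_sub Y Z hXZ ?_ hY
  rw [tendstoInMeasure_iff_norm]
  intro ε hε
  refine tendsto_of_tendsto_of_tendsto_of_le_of_le' tendsto_const_nhds (hXY (ε / 2) (half_pos hε))
    (.of_forall fun _ ↦ zero_le) ?_
  filter_upwards [hX'] with T hT
  refine measure_mono fun ω hω ↦ ?_
  simp only [Set.mem_ofPred_eq, Pi.sub_apply, hT.1, Pi.zero_apply, sub_zero, Real.norm_eq_abs,
    not_le] at hω ⊢
  linarith

/-! ### Pointwise consequences of the Gaussian approximation. -/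

section PartialSums

variable {Ω : Type*}

/-- The partial sums of the errors. -/
def partialSum (e : ℤ → Ω → ℝ) (t : ℕ) (ω : Ω) : ℝ := ∑ s ∈ Finset.Icc 1 t, e (s : ℤ) ω

lemma sum_Icc_one_add_sum_Icc (f : ℕ → ℝ) {t T : ℕ} (h : t ≤ T) :
    ∑ s ∈ Finset.Icc 1 t, f s + ∑ s ∈ Finset.Icc (t + 1) T, f s = ∑ s ∈ Finset.Icc 1 T, f s := by
  have := Finset.sum_Ioc_consecutive f (Nat.zero_le t) h
  simpa [← Finset.Icc_add_one_left_eq_Ioc] using this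

lemma sum_Icc_succ (e : ℤ → Ω → ℝ) {t T : ℕ} (h : t ≤ T) (ω : Ω) :
    ∑ s ∈ Finset.Icc (t + 1) T, e (s : ℤ) ω = partialSum e T ω - partialSum e t ω := by
  rw [partialSum, partialSum, ← sum_Icc_one_add_sum_Icc (fun s ↦ e (s : ℤ) ω) h]
  ring

variable {e : ℤ → Ω → ℝ} {σ κ : ℝ} {W : ℝ≥0 → Ω → ℝ} {T : ℕ} {ω : Ω} {r : ℝ}

lemma abs_sub_le_of_mul_le {x y κ r : ℝ} (hx : 0 < x)
    (h : ENNReal.ofReal (x ^ (-κ) * |y|) ≤ ENNReal.ofReal r) (hr : 0 ≤ r) :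
    |y| ≤ r * x ^ κ := by
  have h1 := (ENNReal.ofReal_le_ofReal_iff hr).1 h
  rw [Real.rpow_neg hx.le] at h1
  have h2 : 0 < x ^ κ := Real.rpow_pos_of_pos hx κ
  rwa [inv_mul_le_iff₀ h2, mul_comm] at h1

lemma abs_partialSum_sub_le (h : headError e σ κ W T ω ≤ ENNReal.ofReal r) (hr : 0 ≤ r) {t : ℕ}
    (h1 : 1 ≤ t) (h2 : 2 * t ≤ T) :
    |partialSum e t ω - σ * W t ω| ≤ r * (t : ℝ) ^ κ := by
  have hmem : (t : ℝ≥0) ∈ Set.Icc (1 : ℝ≥0) ((T : ℝ≥0) / 2) := by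
    refine ⟨by exact_mod_cast h1, ?_⟩
    rw [le_div_iff₀ (by norm_num)]
    exact_mod_cast (by omega : t * 2 ≤ T)
  have h3 := (le_iSup₂ (f := fun (x : ℝ≥0) (_ : x ∈ Set.Icc (1 : ℝ≥0) ((T : ℝ≥0) / 2)) ↦
    ENNReal.ofReal ((x : ℝ) ^ (-κ) * |∑ s ∈ Finset.Icc 1 ⌊x⌋₊, e (s : ℤ) ω - σ * W x ω|))
    (t : ℝ≥0) hmem).trans h
  have h4 := abs_sub_le_of_mul_le (by rw [NNReal.coe_natCast]; exact_mod_cast h1) h3 hr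
  simpa [partialSum] using h4

lemma abs_tail_sub_le (h : tailError e σ κ W T ω ≤ ENNReal.ofReal r) (hr : 0 ≤ r)
    {x : ℝ≥0} (h1 : (T : ℝ≥0) / 2 ≤ x) (h2 : x + 1 ≤ T) :
    |partialSum e T ω - partialSum e ⌊x⌋₊ ω - σ * W ((T : ℝ≥0) - x) ω| ≤
      r * ((T : ℝ) - x) ^ κ := by
  have hmem : x ∈ Set.Icc ((T : ℝ≥0) / 2) ((T : ℝ≥0) - 1) := ⟨h1, le_tsub_of_add_le_right h2⟩
  have h3 := (le_iSup₂ (f := fun (x : ℝ≥0) (_ : x ∈ Set.Icc ((T : ℝ≥0) / 2) ((T : ℝ≥0) - 1)) ↦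
    ENNReal.ofReal (((T : ℝ) - (x : ℝ)) ^ (-κ) *
      |∑ s ∈ Finset.Icc (⌊x⌋₊ + 1) T, e (s : ℤ) ω - σ * W ((T : ℝ≥0) - x) ω|)) x hmem).trans h
  have h2' : (x : ℝ) + 1 ≤ T := by exact_mod_cast h2
  have hfl : ⌊x⌋₊ ≤ T := Nat.floor_le_of_le (le_self_add.trans h2)
  have h4 := abs_sub_le_of_mul_le (by linarith) h3 hr
  rwa [sum_Icc_succ e hfl] at h4

lemma abs_tail_sub_le_natCast (h : tailError e σ κ W T ω ≤ ENNReal.ofReal r) (hr : 0 ≤ r)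
    {k : ℕ} (h1 : 1 ≤ k) (h2 : 2 * k ≤ T) :
    |partialSum e T ω - partialSum e (T - k) ω - σ * W k ω| ≤ r * (k : ℝ) ^ κ := by
  have hk : k ≤ T := by omega
  have hc : ((T - k : ℕ) : ℝ≥0) = (T : ℝ≥0) - k := Nat.cast_tsub T k
  have hcast : (T : ℝ≥0) - ((T - k : ℕ) : ℝ≥0) = k := by
    rw [← Nat.cast_tsub, Nat.sub_sub_self hk]
  have h3 := abs_tail_sub_le h hr (x := ((T - k : ℕ) : ℝ≥0)) ?_ ?_
  · rw [hcast, Nat.floor_natCast] at h3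
    rwa [NNReal.coe_natCast, Nat.cast_sub hk, sub_sub_cancel] at h3
  · rw [div_le_iff₀ (by norm_num)]
    exact_mod_cast (by omega : T ≤ (T - k) * 2)
  · exact_mod_cast (by omega : T - k + 1 ≤ T)

/-- The supremum runs over real `x`, so `x = T / 2` is allowed even for odd `T`. This one point
links the two halves of the sample: it relates `S T` to the partial sum at `⌊T / 2⌋`, which the head
approximation reaches. -/
lemma abs_tail_half_sub_le (h : tailError e σ κ W T ω ≤ ENNReal.ofReal r) (hr : 0 ≤ r)
    (hT : 2 ≤ T) :
    |partialSum e T ω - partialSum e (T / 2) ω - σ * W ((T : ℝ≥0) / 2) ω| ≤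
      r * ((T : ℝ) / 2) ^ κ := by
  have hT' : (2 : ℝ≥0) ≤ T := by exact_mod_cast hT
  have h3 := abs_tail_sub_le h hr (x := (T : ℝ≥0) / 2) le_rfl ?_
  · have e1 : ⌊(T : ℝ≥0) / 2⌋₊ = T / 2 := by
      simpa using Nat.floor_div_eq_div (K := ℝ≥0) T 2
    have e2 : (T : ℝ≥0) - T / 2 = T / 2 := by
      rw [tsub_eq_iff_eq_add_of_le (NNReal.half_le_self _), add_halves]
    rw [e1, e2] at h3
    convert h3 using 3
    push_cast
    ring
  · rw [← NNReal.coe_le_coe] at hT' ⊢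
    push_cast at hT' ⊢
    linarith

end PartialSums

/-! ### The CUSUM drift and deterministic maximisation. -/

section Deterministic

lemma rpow_le_sqrt {x y κ : ℝ} (hx : 1 ≤ x) (hxy : x ≤ y) (hκ : κ ≤ 1 / 2) : x ^ κ ≤ √y := by
  calc x ^ κ ≤ x ^ (1 / 2 : ℝ) := Real.rpow_le_rpow_of_exponent_le hx hκ
    _ = √x := (Real.sqrt_eq_rpow x).symm
    _ ≤ √y := Real.sqrt_le_sqrt hxy

lemma sum_Icc_oneChange {f : ℕ → ℝ} {n T : ℕ} {α β : ℝ} (h1 : ∀ s, 1 ≤ s → s ≤ n → f s = α)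
    (h2 : ∀ s, n + 1 ≤ s → s ≤ T → f s = β) {t : ℕ} (ht : t ≤ T) :
    ∑ s ∈ Finset.Icc 1 t, f s = t * α + (β - α) * (t - min (t : ℝ) n) := by
  induction t with
  | zero => simp
  | succ t ih =>
    rw [Finset.sum_Icc_succ_top (by omega), ih (by omega)]
    by_cases htn : t + 1 ≤ n
    · rw [h1 _ (by omega) htn, min_eq_left (by exact_mod_cast (by omega : t ≤ n)),
        min_eq_left (by exact_mod_cast htn)]
      push_cast
      ring
    · rw [h2 _ (by omega) ht, min_eq_right (by exact_mod_cast (by omega : n ≤ t)),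
        min_eq_right (by exact_mod_cast (by omega : n ≤ t + 1))]
      push_cast
      ring

/-- The drift of the CUSUM process, for a change of size one at time `n`. -/
noncomputable def cusumDrift (T n t : ℕ) : ℝ := min (t : ℝ) n - t * n / T

lemma cusum_eq {x f ε : ℕ → ℝ} {n T : ℕ} {α β : ℝ} (hx : ∀ s, x s = f s + ε s)
    (h1 : ∀ s, 1 ≤ s → s ≤ n → f s = α) (h2 : ∀ s, n + 1 ≤ s → s ≤ T → f s = β)
    (hn : n ≤ T) (hT : 0 < T) {t : ℕ} (ht : t ≤ T) :
    ∑ s ∈ Finset.Icc 1 t, x s - (t : ℝ) / T * ∑ s ∈ Finset.Icc 1 T, x s =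
      (∑ s ∈ Finset.Icc 1 t, ε s - (t : ℝ) / T * ∑ s ∈ Finset.Icc 1 T, ε s) -
        (β - α) * cusumDrift T n t := by
  have hT' : (T : ℝ) ≠ 0 := by positivity
  simp_rw [hx, Finset.sum_add_distrib]
  rw [sum_Icc_oneChange h1 h2 ht, sum_Icc_oneChange h1 h2 le_rfl,
    min_eq_right (by exact_mod_cast hn : (n : ℝ) ≤ T), cusumDrift]
  field_simp
  ring

lemma cusumDrift_self (T n : ℕ) : cusumDrift T n n = n - n * n / T := by simp [cusumDrift]

lemma cusumDrift_of_le {T n t : ℕ} (h : t ≤ n) : cusumDrift T n t = t - t * n / T := by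
  rw [cusumDrift, min_eq_left (by exact_mod_cast h)]

lemma cusumDrift_of_ge {T n t : ℕ} (h : n ≤ t) : cusumDrift T n t = n - t * n / T := by
  rw [cusumDrift, min_eq_right (by exact_mod_cast h)]

lemma cusumDrift_nonneg {T n t : ℕ} (hn : n ≤ T) (ht : t ≤ T) : 0 ≤ cusumDrift T n t := by
  have hn' : (n : ℝ) ≤ T := by exact_mod_cast hn
  have ht' : (t : ℝ) ≤ T := by exact_mod_cast ht
  have hT0 : (0 : ℝ) ≤ T := by positivity
  rw [cusumDrift, sub_nonneg, le_min_iff]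
  constructor
  · exact div_le_of_le_mul₀ hT0 (by positivity) (by gcongr)
  · exact div_le_of_le_mul₀ hT0 (by positivity) (by rw [mul_comm]; gcongr)

/-- The drift is a tent: slope `1 - n / T ≥ 0` before `n`, slope `-n / T` after it. -/
lemma cusumDrift_le {T n t : ℕ} (hn : n ≤ T) (hT : 0 < T) :
    cusumDrift T n t ≤ cusumDrift T n n := by
  have hT' : (0 : ℝ) < T := by exact_mod_cast hT
  have hn' : (n : ℝ) / T ≤ 1 := by rw [div_le_one hT']; exact_mod_cast hn
  have hn0 : (0 : ℝ) ≤ n / T := by positivity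
  rcases le_total t n with h | h
  · rw [cusumDrift_of_le h, cusumDrift_self, mul_div_assoc, mul_div_assoc]
    have : (t : ℝ) ≤ n := by exact_mod_cast h
    nlinarith
  · rw [cusumDrift_of_ge h, cusumDrift_self, mul_div_assoc, mul_div_assoc]
    have : (n : ℝ) ≤ t := by exact_mod_cast h
    nlinarith

lemma le_ciSup_Icc {a b : ℕ} (f : ℕ → ℝ) {t : ℕ} (ht : t ∈ Finset.Icc a b) :
    f t ≤ ⨆ t : Finset.Icc a b, f t :=
  le_ciSup (f := fun t : Finset.Icc a b ↦ f t) (Set.finite_range _).bddAbove ⟨t, ht⟩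

/-- If the noise `Z` has small increments around `n` compared with the loss of drift, then the
maximum of `|Z t - s D g t|` is attained near the maximiser `n` of `g`. -/
lemma abs_iSup_abs_sub_le {T n : ℕ} (hn : n ∈ Finset.Icc 1 T) {Z g : ℕ → ℝ} {D s R : ℝ}
    (hD : 0 ≤ D) (hs : s = 1 ∨ s = -1) (hg : ∀ t ∈ Finset.Icc 1 T, 0 ≤ g t)
    (hgn : ∀ t ∈ Finset.Icc 1 T, g t ≤ g n) (h0 : 2 * |Z n| ≤ D / 2 * g n)
    (H : ∀ t ∈ Finset.Icc 1 T, |Z t - Z n| ≤ R + D / 2 * (g n - g t)) :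
    |(⨆ t : Finset.Icc 1 T, |Z t - s * D * g t|) - D * g n + s * Z n| ≤ R := by
  have hR : 0 ≤ R := by simpa using H n hn
  have : Nonempty (Finset.Icc 1 T) := ⟨⟨n, hn⟩⟩
  have hlow := le_ciSup_Icc (fun t ↦ |Z t - s * D * g t|) hn
  -- For the sign along the drift, `H` costs at most half of the drift lost. For the opposite sign,
  -- `h0` makes the value at the peak large enough to dominate. The lower bound needs only `t = n`.
  have hup : (⨆ t : Finset.Icc 1 T, |Z t - s * D * g t|) ≤ R + D * g n - s * Z n := by
    refine ciSup_le fun ⟨t, ht⟩ ↦ ?_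
    have h1 := abs_le.1 (H t ht)
    have h2 := mul_nonneg hD (hg t ht)
    have h3 := mul_nonneg hD (sub_nonneg.2 (hgn t ht))
    have h4 := abs_le.1 (le_refl |Z n|)
    rcases hs with rfl | rfl <;> refine abs_le.2 ⟨?_, ?_⟩ <;> simp only <;> nlinarith
  rw [abs_le]
  rcases hs with rfl | rfl
  · have := neg_abs_le (Z n - 1 * D * g n)
    constructor <;> linarith
  · have := le_abs_self (Z n - -1 * D * g n)
    constructor <;> linarith

/-- Arithmetic-geometric mean: the two terms on the right have sum at least `√(c * d * x * y)`. It
trades an error `r √k` for a small part of the linear drift loss plus a constant. -/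
lemma mul_sqrt_le_add {r d c x y : ℝ} (hd : 0 ≤ d) (hc : 0 ≤ c) (hx : 0 ≤ x) (hy : 0 ≤ y)
    (h : r ^ 2 ≤ c * (d * y)) : r * √x ≤ d / 16 * x + 4 * (c * y) := by
  refine le_of_sq_le_sq ?_ (by positivity)
  rw [mul_pow, Real.sq_sqrt hx]
  have h1 := mul_le_mul_of_nonneg_right h hx
  nlinarith [sq_nonneg (d / 16 * x - 4 * (c * y))]

end Deterministic

/-! ### Uniform bounds for the Wiener processes and the partial sums. -/

section Lines

variable {Ω : Type*} [MeasurableSpace Ω] {P : Measure Ω}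

/-- The crossing probability is at most `2 exp (-2 δ a)`, so only the product of slope and intercept
has to diverge. -/
lemma whp_abs_le_line {N : ℕ → ℕ} {Z : ℕ → ℕ → Ω → ℝ}
    (hZ : ∀ᶠ T in atTop, IsGaussianWalk P (N T) (Z T)) {a δ : ℕ → ℝ}
    (hδ : ∀ᶠ T in atTop, 0 ≤ δ T) (h : Tendsto (fun T ↦ δ T * a T) atTop atTop) :
    WHP P (fun T ω ↦ ∀ k ≤ N T, |Z T k ω| ≤ a T + δ T * k) := by
  have hlim : Tendsto (fun T ↦ 2 * Real.exp (-(2 * (δ T * a T)))) atTop (𝓝 0) := by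
    have h1 := Real.tendsto_exp_neg_atTop_nhds_zero.comp (h.const_mul_atTop (two_pos (α := ℝ)))
    simpa using h1.const_mul 2
  refine WHP.of_le hlim ?_
  filter_upwards [hZ, hδ] with T hT hδT
  rw [ENNReal.ofReal_mul zero_le_two, ENNReal.ofReal_ofNat, ← mul_assoc 2 (δ T)]
  refine (measure_mono fun ω hω ↦ ?_).trans (hT.measure_exists_le_abs hδT)
  simp only [Set.mem_ofPred_eq, not_forall, not_le] at hω ⊢
  obtain ⟨k, hk, hω⟩ := hω
  exact ⟨k, hk, hω.le⟩

variable {W : ℕ → ℝ≥0 → Ω → ℝ}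

lemma IsWienerOn.ae_eval_zero {a : ℝ≥0} {W : ℝ≥0 → Ω → ℝ} (h : IsWienerOn P a W) :
    ∀ᵐ ω ∂P, W 0 ω = 0 := by
  have := h.hasLaw_eval (zero_le (a := a))
  rw [gaussianReal_zero_var] at this
  exact this.ae_eq_of_dirac

lemma natCast_le_half {k T : ℕ} (h : 2 * k ≤ T) : (k : ℝ≥0) ≤ (T : ℝ≥0) / 2 := by
  rw [le_div_iff₀ (by norm_num)]
  exact_mod_cast (by omega : k * 2 ≤ T)

lemma whp_abs_wiener_le_line (hW : ∀ T : ℕ, IsWienerOn P ((T : ℝ≥0) / 2) (W T)) {a δ : ℕ → ℝ}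
    (hδ : ∀ᶠ T in atTop, 0 ≤ δ T) (h : Tendsto (fun T ↦ δ T * a T) atTop atTop) :
    WHP P (fun T ω ↦ ∀ k : ℕ, 2 * k ≤ T → |W T k ω| ≤ a T + δ T * k) := by
  have h1 : WHP P (fun T ω ↦ ∀ k ≤ T / 2, |W T k ω - W T 0 ω| ≤ a T + δ T * k) := by
    refine whp_abs_le_line (N := fun T ↦ T / 2) (Z := fun T k ω ↦ W T k ω - W T 0 ω)
      (.of_forall fun T ↦ ?_) hδ h
    refine (hW T).isGaussianWalk zero_le (fun k hk ↦ natCast_le_half (by omega))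
      fun j k hjk hk ↦ ?_
    rw [min_eq_left (by exact_mod_cast hjk)]
    simp
  -- The process starts at zero only almost surely.
  have h2 : WHP P (fun T ω ↦ W T 0 ω = 0) :=
    WHP.of_le tendsto_const_nhds (.of_forall fun T ↦ by
      rw [ae_iff.1 (hW T).ae_eval_zero]; exact zero_le)
  refine (h1.and h2).mono (.of_forall fun T ω hω k hk ↦ ?_)
  have := hω.1 k (by omega)
  rwa [hω.2, sub_zero] at this

/-- Increments of the Wiener processes around a time `n T`. -/
lemma whp_abs_increment_le_line (hW : ∀ T : ℕ, IsWienerOn P ((T : ℝ≥0) / 2) (W T)) {n : ℕ → ℕ}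
    (hn : ∀ᶠ T in atTop, 2 * n T ≤ T) {a δ : ℕ → ℝ}
    (hδ : ∀ᶠ T in atTop, 0 ≤ δ T) (h : Tendsto (fun T ↦ δ T * a T) atTop atTop) :
    WHP P (fun T ω ↦ (∀ k ≤ n T, |W T (n T - k : ℕ) ω - W T (n T) ω| ≤ a T + δ T * k) ∧
      ∀ k, 2 * (n T + k) ≤ T → |W T (n T + k : ℕ) ω - W T (n T) ω| ≤ a T + δ T * k) := by
  refine WHP.and ?_ ?_
  -- Read backwards from `n T`, the increments have the covariances of a walk as well.
  · refine whp_abs_le_line (Z := fun T k ω ↦ W T (n T - k : ℕ) ω - W T (n T) ω) ?_ hδ h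
    filter_upwards [hn] with T hT
    refine (hW T).isGaussianWalk (natCast_le_half hT) (u := fun k ↦ (n T - k : ℕ))
      (fun k hk ↦ natCast_le_half (by omega)) fun j k hjk hk ↦ ?_
    rw [min_eq_right (by exact_mod_cast (by omega)), min_eq_left (by exact_mod_cast (by omega)),
      min_eq_right (by exact_mod_cast (by omega))]
    rw [NNReal.coe_natCast, NNReal.coe_natCast, NNReal.coe_natCast, Nat.cast_sub hk,
      Nat.cast_sub (hjk.trans hk)]
    ring
  · have : WHP P (fun T ω ↦ ∀ k ≤ T / 2 - n T,
        |W T (n T + k : ℕ) ω - W T (n T) ω| ≤ a T + δ T * k) := by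
      refine whp_abs_le_line (N := fun T ↦ T / 2 - n T)
        (Z := fun T k ω ↦ W T (n T + k : ℕ) ω - W T (n T) ω) ?_ hδ h
      filter_upwards [hn] with T hT
      refine (hW T).isGaussianWalk (natCast_le_half hT) (u := fun k ↦ (n T + k : ℕ))
        (fun k hk ↦ natCast_le_half (by omega)) fun j k hjk hk ↦ ?_
      rw [min_eq_left (by exact_mod_cast (by omega)), min_eq_right (by exact_mod_cast (by omega)),
        min_eq_left (by exact_mod_cast (by omega))]
      push_cast
      ring
    exact this.mono (.of_forall fun T ω hω k hk ↦ hω k (by omega))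

lemma whp_abs_wiener_le_mul_sqrt (hW : ∀ T : ℕ, IsWienerOn P ((T : ℝ≥0) / 2) (W T))
    {u : ℕ → ℝ≥0} (hu : ∀ᶠ T : ℕ in atTop, 0 < u T ∧ u T ≤ (T : ℝ≥0) / 2) {r : ℕ → ℝ}
    (hr : Tendsto r atTop atTop) : WHP P (fun T ω ↦ |W T (u T) ω| ≤ r T * √(u T)) := by
  have hlim : Tendsto (fun T ↦ (r T ^ 2)⁻¹) atTop (𝓝 0) :=
    tendsto_inv_atTop_zero.comp ((tendsto_pow_atTop two_ne_zero).comp hr)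
  refine WHP.of_le hlim ?_
  filter_upwards [hu, hr.eventually_gt_atTop 0] with T hT hrT
  have hu0 : (0 : ℝ) < u T := by exact_mod_cast hT.1
  have h1 := (hW T).measure_le_abs hT.2 (c := r T * √(u T)) (by positivity)
  rw [mul_pow, Real.sq_sqrt hu0.le] at h1
  have h2 : (u T : ℝ) / (r T ^ 2 * u T) = (r T ^ 2)⁻¹ := by field_simp
  rw [h2] at h1
  refine (measure_mono fun ω hω ↦ ?_).trans h1
  simp only [Set.mem_ofPred_eq, not_le] at hω ⊢
  exact hω.le

variable {e : ℤ → Ω → ℝ} {σ κ : ℝ} {W₁ W₂ : ℕ → ℝ≥0 → Ω → ℝ}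

/-- The head approximation controls the first half and the tail approximation the increments from
the right end. The half-sample point bounds `S T` itself and so joins the two. -/
lemma whp_abs_partialSum_le (hσ : 0 < σ) (hκ : κ ≤ 1 / 2)
    (hW₁ : ∀ T : ℕ, IsWienerOn P ((T : ℝ≥0) / 2) (W₁ T))
    (hW₂ : ∀ T : ℕ, IsWienerOn P ((T : ℝ≥0) / 2) (W₂ T))
    (hhead : BoundedInProb P (fun T ↦ headError e σ κ (W₁ T) T))
    (htail : BoundedInProb P (fun T ↦ tailError e σ κ (W₂ T) T))
    {r : ℕ → ℝ} (hr : Tendsto r atTop atTop) :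
    WHP P (fun T ω ↦ ∀ t ≤ T, |partialSum e t ω| ≤ r T * √T) := by
  -- `S T` costs two portions `(σ + 1) * q T * √T`, and going back from it to `t` costs a third.
  set q : ℕ → ℝ := fun T ↦ r T / (3 * (σ + 1))
  have hq : Tendsto q atTop atTop := hr.atTop_div_const (by positivity)
  have hline {W : ℕ → ℝ≥0 → Ω → ℝ} (hW : ∀ T : ℕ, IsWienerOn P ((T : ℝ≥0) / 2) (W T)) :
      WHP P (fun T ω ↦ ∀ k : ℕ, 2 * k ≤ T → |W T k ω| ≤ q T * √T) := by
    -- Slope times intercept is `q T ^ 2 / 2`, and at `k ≤ T / 2` the line is still below `q T *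
    -- √T`.
    have h1 : WHP P (fun T ω ↦ ∀ k : ℕ, 2 * k ≤ T →
        |W T k ω| ≤ q T * √T / 2 + q T / √T * k) := by
      refine whp_abs_wiener_le_line hW ?_ ?_
      · filter_upwards [hq.eventually_ge_atTop 0] with T hT
        positivity
      · refine Tendsto.congr' ?_ (((tendsto_pow_atTop two_ne_zero).comp hq).atTop_div_const
          (two_pos (α := ℝ)))
        filter_upwards [eventually_gt_atTop 0] with T hT
        have : (0 : ℝ) < √T := by positivity
        simp only [Function.comp_apply]
        field_simp
    refine h1.mono ?_
    filter_upwards [eventually_gt_atTop 0, hq.eventually_ge_atTop 0] with T hT hqT ω hω k hk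
    refine (hω k hk).trans ?_
    have hT' : (0 : ℝ) < √T := by positivity
    have hk' : (k : ℝ) ≤ √T * √T / 2 := by
      rw [Real.mul_self_sqrt (by positivity), le_div_iff₀ two_pos]
      exact_mod_cast (by omega : k * 2 ≤ T)
    have : q T / √T * k ≤ q T / √T * (√T * √T / 2) := by gcongr
    have h3 : q T / √T * (√T * √T / 2) = q T * √T / 2 := by field_simp
    linarith
  have hhalf := whp_abs_wiener_le_mul_sqrt hW₂ (u := fun T ↦ (T : ℝ≥0) / 2)
    (by filter_upwards [eventually_gt_atTop 0] with T hT; exact ⟨by positivity, le_rfl⟩) hq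
  refine ((hhead.whp hq).and ((htail.whp hq).and ((hline hW₁).and ((hline hW₂).and hhalf)))).mono ?_
  filter_upwards [eventually_ge_atTop 2, hq.eventually_ge_atTop 0] with T hT hq0 ω
    ⟨h1, h2, h3, h4, h5⟩
  have hqr : 3 * (σ + 1) * (q T * √T) = r T * √T := by
    simp only [q]; field_simp
  have hqT : 0 ≤ q T * √T := by positivity
  have hpow {x : ℝ} (hx : 1 ≤ x) (hxT : x ≤ T) : q T * x ^ κ ≤ q T * √T := by
    gcongr; exact rpow_le_sqrt hx hxT hκ
  have hhead' : ∀ t, 2 * t ≤ T → |partialSum e t ω| ≤ (σ + 1) * (q T * √T) := by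
    intro t ht
    rcases Nat.eq_zero_or_pos t with rfl | ht0
    · simp only [partialSum, zero_lt_one, Finset.Icc_eq_empty_of_lt, Finset.sum_empty, abs_zero]
      positivity
    have e1 := abs_partialSum_sub_le h1 hq0 ht0 ht
    have e2 := hpow (x := t) (by exact_mod_cast ht0) (by exact_mod_cast (by omega : t ≤ T))
    have e3 := mul_le_mul_of_nonneg_left (h3 t ht) hσ.le
    have e4 : |σ * W₁ T t ω| = σ * |W₁ T t ω| := by rw [abs_mul, abs_of_pos hσ]
    have e5 := abs_sub_abs_le_abs_sub (partialSum e t ω) (σ * W₁ T t ω)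
    linarith
  have htail' : ∀ k, 2 * k ≤ T →
      |partialSum e T ω - partialSum e (T - k) ω| ≤ (σ + 1) * (q T * √T) := by
    intro t ht
    rcases Nat.eq_zero_or_pos t with rfl | ht0
    · simp only [tsub_zero, sub_self, abs_zero]
      positivity
    have e1 := abs_tail_sub_le_natCast h2 hq0 ht0 ht
    have e2 := hpow (x := t) (by exact_mod_cast ht0) (by exact_mod_cast (by omega : t ≤ T))
    have e3 := mul_le_mul_of_nonneg_left (h4 t ht) hσ.le
    have e4 : |σ * W₂ T t ω| = σ * |W₂ T t ω| := by rw [abs_mul, abs_of_pos hσ]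
    have e5 := abs_sub_abs_le_abs_sub (partialSum e T ω - partialSum e (T - t) ω) (σ * W₂ T t ω)
    linarith
  have hfull : |partialSum e T ω| ≤ 2 * (σ + 1) * (q T * √T) := by
    have hT' : (2 : ℝ) ≤ T := by exact_mod_cast hT
    have e1 := abs_tail_half_sub_le h2 hq0 hT
    have e2 := hpow (x := (T : ℝ) / 2) (by linarith) (by linarith)
    have e3 : |W₂ T ((T : ℝ≥0) / 2) ω| ≤ q T * √T := by
      refine h5.trans ?_
      gcongr
      push_cast
      linarith
    have e3 := mul_le_mul_of_nonneg_left e3 hσ.le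
    have e4 : |σ * W₂ T ((T : ℝ≥0) / 2) ω| = σ * |W₂ T ((T : ℝ≥0) / 2) ω| := by
      rw [abs_mul, abs_of_pos hσ]
    have e5 := abs_sub_abs_le_abs_sub (partialSum e T ω - partialSum e (T / 2) ω)
      (σ * W₂ T ((T : ℝ≥0) / 2) ω)
    have e6 := abs_sub_abs_le_abs_sub (partialSum e T ω) (partialSum e (T / 2) ω)
    have e7 := hhead' (T / 2) (by omega)
    linarith
  intro t ht
  have hpos : 0 ≤ (σ + 1) * (q T * √T) := by positivity
  rcases le_or_gt (2 * t) T with h | h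
  · have := hhead' t h
    linarith
  · have e1 := htail' (T - t) (by omega)
    rw [Nat.sub_sub_self ht, abs_sub_comm] at e1
    have e2 := abs_sub_abs_le_abs_sub (partialSum e t ω) (partialSum e T ω)
    linarith

end Lines

/-! ### Deterministic comparison for the CUSUM statistic. -/

section Cusum

/-- Increments of the tied-down partial sums `S t - t / T * S T` around `n`. -/
lemma abs_tiedDown_sub_le {S W : ℕ → ℝ} {σ κ r c D : ℝ} {n T : ℕ} (hσ : 0 < σ) (hκ0 : 0 ≤ κ)
    (hκ : κ ≤ 1 / 2) (hr : 0 ≤ r) (hc : 0 ≤ c) (hD : 0 ≤ D) (hn : 1 ≤ n) (hnT : 4 * n ≤ T)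
    (hS : ∀ t : ℕ, 1 ≤ t → 2 * t ≤ T → |S t - σ * W t| ≤ r * (t : ℝ) ^ κ)
    (hWl : ∀ k ≤ n, |W (n - k) - W n| ≤ c * √n + D * n / T / (4 * σ) * k)
    (hWr : ∀ k, 2 * (n + k) ≤ T → |W (n + k) - W n| ≤ c * √n + D * n / T / (4 * σ) * k)
    (hST : ∀ t ≤ T, |S t| ≤ r * √T)
    (c1 : r * (n : ℝ) ^ κ ≤ c * √n) (c2 : r * n / √T ≤ c * √n)
    (c3 : r ^ 2 ≤ c * (D * n / T * √n)) (c4 : 32 * r ≤ D * n / T * √T)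
    {t : ℕ} (ht : t ∈ Finset.Icc 1 T) :
    |(S t - t / T * S T) - (S n - n / T * S T)| ≤
      (σ + 7) * (c * √n) + D / 2 * (cusumDrift T n n - cusumDrift T n t) := by
  obtain ⟨ht1, htT⟩ := Finset.mem_Icc.1 ht
  have hT0 : (0 : ℝ) < T := by exact_mod_cast (by omega : 0 < T)
  have hnT' : 4 * (n : ℝ) ≤ T := by exact_mod_cast hnT
  have hn0 : (0 : ℝ) < n := by exact_mod_cast hn
  have hsT : 0 < √(T : ℝ) := Real.sqrt_pos.2 hT0
  have hsq : √(T : ℝ) * √T = T := Real.mul_self_sqrt hT0.le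
  have hrT : r * √T / T = r / √T := by rw [div_eq_div_iff hT0.ne' hsT.ne', mul_assoc, hsq]
  set δ : ℝ := D * n / T
  have hδ : 0 ≤ δ := by positivity
  have hcn : 0 ≤ c * √n := by positivity
  have hSn := hS n hn (by omega)
  have hSTT := hST T le_rfl
  have hdecomp : (S t - t / T * S T) - (S n - n / T * S T) =
      (S t - S n) - ((t : ℝ) - n) / T * S T := by ring
  rw [hdecomp]
  have htri := abs_sub (S t - S n) (((t : ℝ) - n) / T * S T)
  have hincr : ∀ {x : ℝ}, |W t - W n| ≤ x → 2 * t ≤ T →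
      |S t - S n| ≤ σ * x + r * (t : ℝ) ^ κ + c * √n := by
    intro x hx h2
    have e1 := hS t ht1 h2
    have e2 : S t - S n = (S t - σ * W t) + σ * (W t - W n) - (S n - σ * W n) := by ring
    have e3 := abs_sub ((S t - σ * W t) + σ * (W t - W n)) (S n - σ * W n)
    have e4 := abs_add_le (S t - σ * W t) (σ * (W t - W n))
    rw [abs_mul, abs_of_pos hσ] at e4
    have e5 := mul_le_mul_of_nonneg_left hx hσ.le
    rw [e2]
    linarith
  have hST' : |((t : ℝ) - n) / T * S T| ≤ |(t : ℝ) - n| * (r / √T) := by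
    rw [abs_mul, abs_div, abs_of_pos hT0]
    calc |(t : ℝ) - n| / T * |S T| ≤ |(t : ℝ) - n| / T * (r * √T) := by gcongr
      _ = |(t : ℝ) - n| * (r / √T) := by rw [← hrT]; ring
  -- Left of `n` the drift falls much faster, with slope at least `3 / 4` per unit of `D`.
  rcases le_total t n with htn | htn
  · have htn' : (t : ℝ) ≤ n := by exact_mod_cast htn
    have e1 := hWl (n - t) (by omega)
    rw [Nat.sub_sub_self htn, Nat.cast_sub htn] at e1
    have e2 := hincr e1 (by omega)
    have e3 : r * (t : ℝ) ^ κ ≤ r * (n : ℝ) ^ κ := by gcongr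
    have e4 : |(t : ℝ) - n| * (r / √T) ≤ c * √n := by
      refine le_trans ?_ c2
      rw [mul_div_assoc', mul_comm]
      gcongr
      rw [abs_of_nonpos (by linarith)]
      have : (0 : ℝ) ≤ t := by positivity
      linarith
    have e5 : σ * (δ / (4 * σ) * ((n : ℝ) - t)) = δ / 4 * (n - t) := by field_simp
    have e6 : cusumDrift T n n - cusumDrift T n t = ((n : ℝ) - t) * (1 - n / T) := by
      rw [cusumDrift_self, cusumDrift_of_le htn]; ring
    have e7 : (n : ℝ) / T ≤ 1 / 4 := by rw [div_le_iff₀ hT0]; linarith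
    have e8 : δ ≤ D * (1 / 4) := by
      simp only [δ]; rw [mul_div_assoc]; gcongr
    have e9 : δ / 4 * (n - t) ≤ D / 2 * (((n : ℝ) - t) * (1 - n / T)) := by
      have h1 : 0 ≤ (n : ℝ) - t := by linarith
      have h2 : δ / 4 ≤ D / 2 * (1 - n / T) := by nlinarith
      calc δ / 4 * (n - t) ≤ D / 2 * (1 - n / T) * (n - t) := by gcongr
        _ = _ := by ring
    rw [e6]
    linarith
  · obtain ⟨k, rfl⟩ := Nat.exists_eq_add_of_le htn
    have hk0 : (0 : ℝ) ≤ k := by positivity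
    have e6 : D / 2 * (cusumDrift T n n - cusumDrift T n (n + k)) = δ / 2 * k := by
      rw [cusumDrift_self, cusumDrift_of_ge htn]
      simp only [δ]
      push_cast
      ring
    rw [e6]
    have e7 : |((n + k : ℕ) : ℝ) - n| = k := by
      push_cast
      rw [add_sub_cancel_left, abs_of_nonneg hk0]
    rw [e7] at hST'
    have e8 : r / √T ≤ δ / 32 := by
      rw [div_le_iff₀ hsT]; linarith
    have e9 : k * (r / √T) ≤ k * (δ / 32) := by gcongr
    rcases le_or_gt (2 * (n + k)) T with h2 | h2
    · have f1 := hincr (hWr k h2) h2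
      -- Subadditivity of the power splits the error into a part at scale `n`, absorbed by `c √n`,
      -- and a part `r √k`, absorbed by the drift.
      have f2 : r * ((n + k : ℕ) : ℝ) ^ κ ≤ r * (n : ℝ) ^ κ + r * √k := by
        rcases Nat.eq_zero_or_pos k with rfl | hk
        · simp
        have hk1 : (1 : ℝ) ≤ k := by exact_mod_cast hk
        have g1 : ((n + k : ℕ) : ℝ) ^ κ ≤ (n : ℝ) ^ κ + (k : ℝ) ^ κ := by
          push_cast
          exact Real.rpow_add_le_add_rpow hn0.le hk0 hκ0 (by linarith)
        have g2 := rpow_le_sqrt hk1 le_rfl hκ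
        rw [← mul_add]
        gcongr
        linarith
      have f3 := mul_sqrt_le_add hδ hc hk0 (Real.sqrt_nonneg n) c3
      have f5 : σ * (δ / (4 * σ) * k) = δ / 4 * k := by field_simp
      have f6 : 0 ≤ δ * k := by positivity
      linarith
    -- Past the middle, `k ≥ T / 4`: the drift loss, of order `δ T`, outweighs the crude bound `r
    -- √T` on the partial sums.
    · have f1 := hST (n + k) htT
      have f2 := hST n (by omega)
      have f3 := abs_sub (S (n + k)) (S n)
      have f4 : (T : ℝ) ≤ 4 * k := by exact_mod_cast (by omega : T ≤ 4 * k)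
      have f5 : r * √T ≤ δ / 32 * T := by
        calc r * √T ≤ (δ * √T / 32) * √T := by gcongr; linarith
          _ = δ / 32 * (√T * √T) := by ring
          _ = δ / 32 * T := by rw [hsq]
      have f6 : δ / 32 * T ≤ δ / 32 * (4 * k) := by gcongr
      have f7 : 0 ≤ (σ + 7) * (c * √n) := by positivity
      have f8 : 0 ≤ δ * k := by positivity
      linarith

/-- The CUSUM maximum, centred at its drift, is close to the noise at the time of change. -/
lemma abs_iSup_cusum_le {S W : ℕ → ℝ} {σ κ r c D s : ℝ} {n T : ℕ} (hσ : 0 < σ) (hκ0 : 0 ≤ κ)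
    (hκ : κ ≤ 1 / 2) (hr : 0 ≤ r) (hc : 0 ≤ c) (hD : 0 ≤ D) (hs : s = 1 ∨ s = -1)
    (hn : 1 ≤ n) (hnT : 4 * n ≤ T)
    (hS : ∀ t : ℕ, 1 ≤ t → 2 * t ≤ T → |S t - σ * W t| ≤ r * (t : ℝ) ^ κ)
    (hWl : ∀ k ≤ n, |W (n - k) - W n| ≤ c * √n + D * n / T / (4 * σ) * k)
    (hWr : ∀ k, 2 * (n + k) ≤ T → |W (n + k) - W n| ≤ c * √n + D * n / T / (4 * σ) * k)
    (hWn : |W n| ≤ r * √n) (hST : ∀ t ≤ T, |S t| ≤ r * √T)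
    (c1 : r * (n : ℝ) ^ κ ≤ c * √n) (c2 : r * n / √T ≤ c * √n)
    (c3 : r ^ 2 ≤ c * (D * n / T * √n)) (c4 : 32 * (σ + 1) * r ≤ D * n / T * √T) :
    |(⨆ t : Finset.Icc 1 T, |(S t - (t : ℕ) / T * S T) - s * D * cusumDrift T n t|)
      - D * cusumDrift T n n + s * (σ * W n)| ≤ (σ + 9) * (c * √n) := by
  have hT : 0 < T := by omega
  have hT0 : (0 : ℝ) < T := by exact_mod_cast hT
  have hn1 : (1 : ℝ) ≤ n := by exact_mod_cast hn
  have hnT' : 4 * (n : ℝ) ≤ T := by exact_mod_cast hnT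
  have hsT : 0 < √(T : ℝ) := Real.sqrt_pos.2 hT0
  have hsq : √(T : ℝ) * √T = T := Real.mul_self_sqrt hT0.le
  have hrT : r * √T / T = r / √T := by rw [div_eq_div_iff hT0.ne' hsT.ne', mul_assoc, hsq]
  have hnle : √(n : ℝ) ≤ √T := Real.sqrt_le_sqrt (by linarith)
  have hSn := hS n hn (by omega)
  have hSTT := hST T le_rfl
  have hnST : |(n : ℝ) / T * S T| ≤ r * n / √T := by
    rw [abs_mul, abs_of_nonneg (by positivity)]
    calc (n : ℝ) / T * |S T| ≤ n / T * (r * √T) := by gcongr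
      _ = n * (r * √T / T) := by ring
      _ = r * n / √T := by rw [hrT]; ring
  have hnST2 : r * n / √T ≤ r * √n := by
    rw [div_le_iff₀ hsT, mul_assoc]
    gcongr
    calc (n : ℝ) = √n * √n := (Real.mul_self_sqrt (by positivity)).symm
      _ ≤ √n * √T := by gcongr
  have hmain := abs_iSup_abs_sub_le (T := T) (n := n) (Z := fun t ↦ S t - t / T * S T)
    (g := cusumDrift T n) (D := D) (s := s) (R := (σ + 7) * (c * √n))
    (Finset.mem_Icc.2 ⟨hn, by omega⟩) hD hs
    (fun t ht ↦ cusumDrift_nonneg (by omega) (Finset.mem_Icc.1 ht).2)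
    (fun t _ ↦ cusumDrift_le (by omega) hT) ?_
    (fun t ht ↦ abs_tiedDown_sub_le hσ hκ0 hκ hr hc hD hn hnT hS hWl hWr hST c1 c2 c3
      (le_trans (by nlinarith) c4) ht)
  · have e1 : |s * (σ * W n) - s * (S n - n / T * S T)| ≤ 2 * (c * √n) := by
      have e2 : s * (σ * W n) - s * (S n - n / T * S T) =
          -(s * ((S n - σ * W n) - n / T * S T)) := by ring
      have e3 : |s| = 1 := by rcases hs with rfl | rfl <;> simp
      rw [e2, abs_neg, abs_mul, e3, one_mul]
      have e4 := abs_sub (S n - σ * W n) (n / T * S T)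
      linarith
    have e5 := abs_add_le ((⨆ t : Finset.Icc 1 T,
      |(S t - (t : ℕ) / T * S T) - s * D * cusumDrift T n t|) - D * cusumDrift T n n
        + s * (S n - n / T * S T)) (s * (σ * W n) - s * (S n - n / T * S T))
    refine le_trans (le_of_eq ?_) (e5.trans (by linarith))
    congr 1
    ring
  · have e1 : |S n| ≤ (σ + 1) * (r * √n) := by
      have f1 := abs_sub_abs_le_abs_sub (S n) (σ * W n)
      rw [abs_mul, abs_of_pos hσ] at f1
      have f2 := mul_le_mul_of_nonneg_left hWn hσ.le
      have f3 : r * (n : ℝ) ^ κ ≤ r * √n := by gcongr; exact rpow_le_sqrt hn1 le_rfl hκ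
      linarith
    have e2 := abs_sub (S n) (n / T * S T)
    have e3 : 32 * (σ + 1) * (r * √n) ≤ D * n := by
      calc 32 * (σ + 1) * (r * √n) = 32 * (σ + 1) * r * √n := by ring
        _ ≤ D * n / T * √T * √T := by gcongr
        _ = D * n := by rw [mul_assoc, hsq]; field_simp
    have e4 : D * n * (3 / 4) ≤ D * cusumDrift T n n := by
      rw [mul_assoc]
      gcongr
      have f1 : (n : ℝ) * n / T ≤ n * (1 / 4) := by
        rw [mul_div_assoc]
        have f2 : (n : ℝ) / T ≤ 1 / 4 := by rw [div_le_iff₀ hT0]; linarith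
        gcongr
      rw [cusumDrift_self]
      linarith
    have e5 : 0 ≤ r * √n := by positivity
    nlinarith

end Cusum

/-! ### Deterministic comparison for the Rényi statistic. -/

section Renyi

/-- The drift of the Rényi process, for a change of size one at time `n`. -/
noncomputable def renyiDrift (T n t : ℕ) : ℝ :=
  min (t : ℝ) n / t - (n - min (t : ℝ) n) / (T - t)

lemma renyi_eq {x f ε : ℕ → ℝ} {n T : ℕ} {α β : ℝ} (hx : ∀ s, x s = f s + ε s)
    (h1 : ∀ s, 1 ≤ s → s ≤ n → f s = α) (h2 : ∀ s, n + 1 ≤ s → s ≤ T → f s = β)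
    (hn : n ≤ T) {t : ℕ} (ht1 : 1 ≤ t) (ht : t < T) :
    1 / (t : ℝ) * ∑ s ∈ Finset.Icc 1 t, x s -
        1 / ((T : ℝ) - t) * ∑ s ∈ Finset.Icc (t + 1) T, x s =
      (1 / (t : ℝ) * ∑ s ∈ Finset.Icc 1 t, ε s - 1 / ((T : ℝ) - t) *
        (∑ s ∈ Finset.Icc 1 T, ε s - ∑ s ∈ Finset.Icc 1 t, ε s)) -
        (β - α) * renyiDrift T n t := by
  have ht0 : (t : ℝ) ≠ 0 := by positivity
  have hTt : (T : ℝ) - t ≠ 0 := by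
    have : (t : ℝ) < T := by exact_mod_cast ht
    linarith
  have hsum : ∑ s ∈ Finset.Icc (t + 1) T, x s =
      ∑ s ∈ Finset.Icc 1 T, x s - ∑ s ∈ Finset.Icc 1 t, x s := by
    rw [← sum_Icc_one_add_sum_Icc x ht.le]; ring
  rw [hsum]
  simp_rw [hx, Finset.sum_add_distrib]
  rw [sum_Icc_oneChange h1 h2 ht.le, sum_Icc_oneChange h1 h2 le_rfl,
    min_eq_right (by exact_mod_cast hn : (n : ℝ) ≤ T), renyiDrift]
  field_simp
  ring

lemma renyiDrift_of_le {T n t : ℕ} (h : t ≤ n) (ht : 1 ≤ t) :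
    renyiDrift T n t = 1 - ((n : ℝ) - t) / (T - t) := by
  have : (t : ℝ) ≠ 0 := by positivity
  rw [renyiDrift, min_eq_left (by exact_mod_cast h), div_self this]

lemma renyiDrift_of_ge {T n t : ℕ} (h : n ≤ t) : renyiDrift T n t = n / t := by
  rw [renyiDrift, min_eq_right (by exact_mod_cast h), sub_self, zero_div, sub_zero]

/-- If the noise `q * Y` is close to `x` on `[m, n]`, small from `n` to the middle of the sample,
and dominated by the loss of drift in the second half, then the maximum of `|Y t - D * h t|` behaves
like that of `-x` over `[m, n]`. -/
lemma abs_iSup_abs_sub_iSup_le {Y x h : ℕ → ℝ} {q D B ε η : ℝ} {m n T : ℕ} (hq : 0 < q)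
    (hD : 0 ≤ D) (hε : 0 ≤ ε) (hη : 0 ≤ η) (hmn : m ≤ n) (hnT : 4 * n ≤ T)
    (hnear : ∀ t ∈ Finset.Icc m n, |q * Y t - x t| ≤ ε)
    (hmid : ∀ t, n ≤ t → 2 * t ≤ T → |q * Y t| ≤ η) (hxn : |x n| ≤ η)
    (hall : ∀ t ∈ Finset.Icc m (T - m), |q * Y t| ≤ B)
    (hh : ∀ t ∈ Finset.Icc m (T - m), 0 ≤ h t ∧ h t ≤ 1)
    (hgap : ∀ t ∈ Finset.Icc m n, q * D * (1 - h t) ≤ ε)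
    (hhalf : ∀ t ∈ Finset.Icc m (T - m), T < 2 * t → h t ≤ 1 / 2) (hB : B + η ≤ q * D / 2) :
    |q * ((⨆ t : Finset.Icc m (T - m), |Y t - D * h t|) - D) - ⨆ k : Finset.Icc m n, -x k| ≤
      2 * ε + 2 * η := by
  set X : ℝ := ⨆ k : Finset.Icc m n, -x k
  set M : ℝ := ⨆ t : Finset.Icc m (T - m), |Y t - D * h t|
  have hqD : 0 ≤ q * D := by positivity
  have hXle : ∀ k ∈ Finset.Icc m n, -x k ≤ X := fun k hk ↦ le_ciSup_Icc (fun k ↦ -x k) hk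
  have hXn : -η ≤ X := by
    have e1 := hXle n (Finset.mem_Icc.2 ⟨hmn, le_rfl⟩)
    linarith [le_abs_self (x n)]
  have hup : q * (M - D) ≤ X + (ε + 2 * η) := by
    have hne : Nonempty (Finset.Icc m (T - m)) :=
      ⟨⟨m, Finset.mem_Icc.2 ⟨le_rfl, by omega⟩⟩⟩
    have hM : M ≤ D + (X + (ε + 2 * η)) / q := by
      refine ciSup_le fun ⟨t, ht⟩ ↦ ?_
      rw [← sub_le_iff_le_add', le_div_iff₀ hq]
      have hb := abs_le.1 (hall t ht)
      have h0 := mul_nonneg hqD (hh t ht).1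
      have h1 := mul_nonneg hqD (sub_nonneg.2 (hh t ht).2)
      -- With this sign the drift does not help, and the noise alone cannot reach `D`.
      have hpos : (Y t - D * h t - D) * q ≤ X + (ε + 2 * η) := by
        clear hnear hmid hall hh hgap hhalf hXle
        linarith
      -- Before `n` the noise is compared with `X`; up to the middle, `h ≤ 1` and small noise
      -- suffice, as `X ≥ -η`; beyond it half of `q * D` is lost.
      have hneg : (-(Y t - D * h t) - D) * q ≤ X + (ε + 2 * η) := by
        obtain ⟨ht1, ht2⟩ := Finset.mem_Icc.1 ht
        rcases le_total t n with htn | htn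
        · have g3 := hXle t (Finset.mem_Icc.2 ⟨ht1, htn⟩)
          have g4 := abs_le.1 (hnear t (Finset.mem_Icc.2 ⟨ht1, htn⟩))
          clear hnear hmid hall hh hgap hhalf hXle
          linarith
        · rcases le_or_gt (2 * t) T with h2 | h2
          · have g4 := abs_le.1 (hmid t htn h2)
            clear hnear hmid hall hh hgap hhalf hXle
            linarith
          · have g1 := mul_le_mul_of_nonneg_left (hhalf t ht h2) hqD
            clear hnear hmid hall hh hgap hhalf hXle
            linarith
      rcases abs_choice (Y t - D * h t) with hc | hc
      · simpa only [hc] using hpos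
      · simpa only [hc] using hneg
    have := mul_le_mul_of_nonneg_left hM hq.le
    rw [mul_add, mul_div_cancel₀ _ hq.ne'] at this
    linarith
  have hlow : X ≤ q * (M - D) + 2 * ε := by
    have hne : Nonempty (Finset.Icc m n) := ⟨⟨m, Finset.mem_Icc.2 ⟨le_rfl, hmn⟩⟩⟩
    refine ciSup_le fun ⟨t, ht⟩ ↦ ?_
    obtain ⟨ht1, ht2⟩ := Finset.mem_Icc.1 ht
    have g1 := hgap t ht
    have g2 := abs_le.1 (hnear t ht)
    have g3 : |Y t - D * h t| ≤ M :=
      le_ciSup_Icc (fun t ↦ |Y t - D * h t|) (Finset.mem_Icc.2 ⟨ht1, by omega⟩)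
    have g5 := mul_le_mul_of_nonneg_left ((neg_le_abs _).trans g3) hq.le
    simp only
    linarith
  rw [abs_le]
  constructor <;> linarith

/-- The Rényi maximum, centred at the size of the change, is close to the maximum of the noise
before the change. -/
lemma abs_iSup_renyi_le {S W V : ℕ → ℝ} {σ κ r c D s : ℝ} {m n T : ℕ} (hσ : 0 < σ)
    (hκ : κ ≤ 1 / 2) (hc : 0 ≤ c) (hD : 0 ≤ D) (hs : s = 1 ∨ s = -1)
    (hm : 1 ≤ m) (hmn : m ≤ n) (hnT : 4 * n ≤ T)
    (hS : ∀ t : ℕ, 1 ≤ t → 2 * t ≤ T → |S t - σ * W t| ≤ r * (t : ℝ) ^ κ)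
    (hSV : ∀ k : ℕ, 1 ≤ k → 2 * k ≤ T → |S T - S (T - k) - σ * V k| ≤ r * (k : ℝ) ^ κ)
    (hW : ∀ k, m ≤ k → 2 * k ≤ T → √m * |W k| ≤ r * k)
    (hV : ∀ k, m ≤ k → 2 * k ≤ T → √m * |V k| ≤ r * k)
    (hWn : ∀ k, n ≤ k → 2 * k ≤ T → √m * |W k| ≤ c * k)
    (hST : ∀ t ≤ T, |S t| ≤ r * √T)
    (c1 : r * (m : ℝ) ^ κ ≤ c * √m) (c2 : r * √m ≤ c * √T) (c3 : √m * n * D / T ≤ c)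
    (c4 : 2 * σ * r + (4 * σ + 20) * c ≤ √m * D) :
    |√m * ((⨆ t : Finset.Icc m (T - m), |(1 / ((t : ℕ) : ℝ) * S t - 1 / ((T : ℝ) - (t : ℕ)) *
      (S T - S t)) - s * D * renyiDrift T n t|) - D) -
      σ * ⨆ k : Finset.Icc m n, -s * (√m / (k : ℕ)) * W k| ≤ (2 * σ + 20) * c := by
  have hT0 : (0 : ℝ) < T := by exact_mod_cast (by omega : 0 < T)
  have hm0 : (0 : ℝ) < m := by exact_mod_cast hm
  have hsT : 0 < √(T : ℝ) := Real.sqrt_pos.2 hT0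
  have hsm : 0 < √(m : ℝ) := Real.sqrt_pos.2 hm0
  have hsq : √(T : ℝ) * √T = T := Real.mul_self_sqrt hT0.le
  have hsqm : √(m : ℝ) * √m = m := Real.mul_self_sqrt hm0.le
  have hnT' : 4 * (n : ℝ) ≤ T := by exact_mod_cast hnT
  set Y : ℕ → ℝ := fun t ↦ 1 / (t : ℝ) * S t - 1 / ((T : ℝ) - t) * (S T - S t)
  -- Since `κ ≤ 1 / 2`, the approximation error relative to `√t` is worst at `t = m`, where `c1`
  -- controls it.
  have hpow : ∀ t : ℕ, m ≤ t → √m * (r * (t : ℝ) ^ κ) ≤ c * t := by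
    intro t ht
    have ht' : (m : ℝ) ≤ t := by exact_mod_cast ht
    have ht0 : (0 : ℝ) < t := hm0.trans_le ht'
    have e1 : (t : ℝ) ^ κ = (m : ℝ) ^ κ * ((t : ℝ) / m) ^ κ := by
      rw [← Real.mul_rpow hm0.le (by positivity)]
      congr 1
      field_simp
    have e2 : ((t : ℝ) / m) ^ κ ≤ √(t / m) :=
      rpow_le_sqrt ((one_le_div hm0).2 ht') le_rfl hκ
    have e3 : √m * √((t : ℝ) / m) = √t := by
      rw [← Real.sqrt_mul hm0.le]; congr 1; field_simp
    calc √m * (r * (t : ℝ) ^ κ) = (r * (m : ℝ) ^ κ) * (√m * ((t : ℝ) / m) ^ κ) := by rw [e1]; ring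
      _ ≤ (c * √m) * (√m * √((t : ℝ) / m)) := by gcongr
      _ = c * (√m * √t) := by rw [e3]; ring
      _ ≤ c * (√t * √t) := by gcongr
      _ = c * t := by rw [Real.mul_self_sqrt ht0.le]
  have hbulk : √m * (r * √T) ≤ c * T := by
    calc √m * (r * √T) = (r * √m) * √T := by ring
      _ ≤ (c * √T) * √T := by gcongr
      _ = c * T := by rw [mul_assoc, hsq]
  have hdiv {x y : ℝ} {k : ℝ} (hk : 0 < k) (h : √m * |x| ≤ y * k) : |√m * (1 / k * x)| ≤ y := by
    rw [abs_mul, abs_mul, abs_of_pos hsm, abs_of_pos (one_div_pos.2 hk)]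
    calc √m * (1 / k * |x|) = (√m * |x|) / k := by ring
      _ ≤ y := by rwa [div_le_iff₀ hk]
  -- The mean over the later, longer stretch averages at least `T / 2` terms and is negligible at
  -- scale `1 / √m`.
  have hsecond : ∀ t : ℕ, 2 * t ≤ T → |√m * (1 / ((T : ℝ) - t) * (S T - S t))| ≤ 4 * c := by
    intro t ht
    have ht' : 2 * (t : ℝ) ≤ T := by exact_mod_cast ht
    refine hdiv (by linarith) ?_
    have e1 := hST T le_rfl
    have e2 := hST t (by omega)
    have e3 := abs_sub (S T) (S t)
    have e4 : √m * |S T - S t| ≤ √m * (2 * (r * √T)) := by gcongr; linarith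
    nlinarith
  have hfirst : ∀ t : ℕ, m ≤ t → 2 * t ≤ T →
      |√m * (1 / (t : ℝ) * S t) - σ * (√m / t * W t)| ≤ c := by
    intro t ht h2
    have ht0 : (0 : ℝ) < t := by exact_mod_cast (by omega : 0 < t)
    have e1 : √m * |S t - σ * W t| ≤ c * t :=
      (mul_le_mul_of_nonneg_left (hS t (by omega) h2) hsm.le).trans (hpow t ht)
    have e2 := hdiv ht0 e1
    refine le_trans (le_of_eq ?_) e2
    congr 1
    ring
  have hnear : ∀ t : ℕ, m ≤ t → 2 * t ≤ T → |√m * Y t - σ * (√m / t * W t)| ≤ 5 * c := by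
    intro t ht h2
    have e1 := hfirst t ht h2
    have e2 := hsecond t h2
    have e3 := abs_sub (√m * (1 / (t : ℝ) * S t) - σ * (√m / t * W t))
      (√m * (1 / ((T : ℝ) - t) * (S T - S t)))
    refine le_trans (le_of_eq ?_) (e3.trans (by linarith))
    congr 1
    simp only [Y]
    ring
  have hWdiv {y : ℝ} {t : ℕ} (ht : 1 ≤ t) (h : √m * |W t| ≤ y * t) :
      |σ * (√m / t * W t)| ≤ σ * y := by
    have ht0 : (0 : ℝ) < t := by exact_mod_cast ht
    rw [abs_mul, abs_of_pos hσ]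
    gcongr
    refine le_trans (le_of_eq ?_) (hdiv ht0 h)
    congr 1
    ring
  have hmid : ∀ t : ℕ, n ≤ t → 2 * t ≤ T → |√m * Y t| ≤ (σ + 5) * c := by
    intro t ht h2
    have e1 := hnear t (hmn.trans ht) h2
    have e2 := hWdiv (by omega) (hWn t ht h2)
    have e3 := abs_sub_abs_le_abs_sub (√m * Y t) (σ * (√m / t * W t))
    linarith
  have hall : ∀ t ∈ Finset.Icc m (T - m), |√m * Y t| ≤ σ * r + 5 * c := by
    intro t ht
    obtain ⟨ht1, ht2⟩ := Finset.mem_Icc.1 ht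
    rcases le_or_gt (2 * t) T with h2 | h2
    · have e1 := hnear t ht1 h2
      have e2 := hWdiv (by omega) (hW t ht1 h2)
      have e3 := abs_sub_abs_le_abs_sub (√m * Y t) (σ * (√m / t * W t))
      linarith
    -- In the second half the roles are exchanged: the right mean has only `k ≥ m` terms and is
    -- governed by the process `V` from the right end.
    · obtain ⟨k, hk⟩ : ∃ k, k = T - t := ⟨_, rfl⟩
      have hkt : T - k = t := by omega
      have hkr : (T : ℝ) - t = k := by rw [hk, Nat.cast_sub (by omega)]
      have hk0 : (0 : ℝ) < k := by exact_mod_cast (by omega : 0 < k)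
      have ht0 : (0 : ℝ) < t := by exact_mod_cast (by omega : 0 < t)
      have h2' : (T : ℝ) ≤ 2 * t := by exact_mod_cast h2.le
      have e1 : |√m * (1 / (t : ℝ) * S t)| ≤ 2 * c := by
        refine hdiv ht0 ?_
        have f1 : √m * |S t| ≤ √m * (r * √T) := by gcongr; exact hST t (by omega)
        nlinarith
      have e2 := hSV k (by omega) (by omega)
      rw [hkt] at e2
      have e3 : |√m * (1 / ((T : ℝ) - t) * (S T - S t))| ≤ σ * r + c := by
        rw [hkr]
        refine hdiv hk0 ?_
        have f1 := abs_sub_abs_le_abs_sub (S T - S t) (σ * V k)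
        rw [abs_mul σ, abs_of_pos hσ] at f1
        have f2 := mul_le_mul_of_nonneg_left (hV k (by omega) (by omega)) hσ.le
        have f3 := hpow k (by omega)
        have f4 : |S T - S t| ≤ σ * |V k| + r * (k : ℝ) ^ κ := by linarith
        have f5 := mul_le_mul_of_nonneg_left f4 hsm.le
        linarith
      have e4 := abs_sub (√m * (1 / (t : ℝ) * S t)) (√m * (1 / ((T : ℝ) - t) * (S T - S t)))
      rw [← mul_sub] at e4
      change |√m * Y t| ≤ _ at e4
      linarith
  have hσc : 0 ≤ σ * c := by positivity
  have hgap : ∀ t ∈ Finset.Icc m n, √m * D * (1 - renyiDrift T n t) ≤ 2 * c := by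
    intro t ht
    obtain ⟨ht1, ht2⟩ := Finset.mem_Icc.1 ht
    have ht2' : (t : ℝ) ≤ n := by exact_mod_cast ht2
    have ht0 : (0 : ℝ) ≤ t := by positivity
    rw [renyiDrift_of_le ht2 (by omega), sub_sub_cancel]
    have e1 : ((n : ℝ) - t) / (T - t) ≤ 2 * (n / T) := by
      rw [div_le_iff₀ (by linarith)]
      calc (n : ℝ) - t ≤ n := by linarith
        _ = 2 * (n / T) * (T / 2) := by field_simp
        _ ≤ 2 * (n / T) * (T - t) := by gcongr; linarith
    calc √m * D * (((n : ℝ) - t) / (T - t)) ≤ √m * D * (2 * (n / T)) := by gcongr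
      _ = 2 * (√m * n * D / T) := by ring
      _ ≤ 2 * c := by gcongr
  have hdrift : ∀ t ∈ Finset.Icc m (T - m), 0 ≤ renyiDrift T n t ∧ renyiDrift T n t ≤ 1 := by
    intro t ht
    obtain ⟨ht1, ht2⟩ := Finset.mem_Icc.1 ht
    rcases le_total t n with htn | htn
    · have h1 : (t : ℝ) ≤ n := by exact_mod_cast htn
      rw [renyiDrift_of_le htn (by omega), sub_nonneg, sub_le_self_iff, div_le_one (by linarith)]
      exact ⟨by linarith, div_nonneg (by linarith) (by linarith)⟩
    · rw [renyiDrift_of_ge htn]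
      exact ⟨by positivity, div_le_one_of_le₀ (by exact_mod_cast htn) (by positivity)⟩
  have hhalf : ∀ t ∈ Finset.Icc m (T - m), T < 2 * t → renyiDrift T n t ≤ 1 / 2 := by
    intro t ht h2
    have h2' : (T : ℝ) < 2 * t := by exact_mod_cast h2
    rw [renyiDrift_of_ge (by omega), div_le_iff₀ (by linarith)]
    linarith
  have hxn : |σ * (√m / n * W n)| ≤ (σ + 5) * c := by
    have := hWdiv (by omega) (hWn n le_rfl (by omega))
    linarith
  have hη : 0 ≤ (σ + 5) * c := by positivity
  -- Multiplying the noise by `s` reduces both directions of change to an upward drift subtracted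
  -- from noise.
  have key : ∀ s : ℝ, s = 1 ∨ s = -1 →
      |√m * ((⨆ t : Finset.Icc m (T - m), |s * Y t - D * renyiDrift T n t|) - D) -
        ⨆ k : Finset.Icc m n, -(s * (σ * (√m / (k : ℕ) * W k)))| ≤
      2 * (5 * c) + 2 * ((σ + 5) * c) := by
    intro s hs
    have hs1 : |s| = 1 := by rcases hs with rfl | rfl <;> simp
    have habs (y : ℝ) : |√m * (s * y)| = |√m * y| := by
      rw [mul_left_comm, abs_mul, hs1, one_mul]
    refine abs_iSup_abs_sub_iSup_le (Y := fun t ↦ s * Y t)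
      (x := fun t ↦ s * (σ * (√m / (t : ℕ) * W t))) (h := renyiDrift T n) hsm hD (by positivity) hη
      hmn hnT (fun t ht ↦ ?_) (fun t h1 h2 ↦ ?_) ?_ (B := σ * r + 5 * c) (fun t ht ↦ ?_) hdrift
      (fun t ht ↦ (hgap t ht).trans (by linarith)) hhalf (by linarith)
    · obtain ⟨ht1, ht2⟩ := Finset.mem_Icc.1 ht
      rw [mul_left_comm, ← mul_sub, abs_mul, hs1, one_mul]
      exact hnear t ht1 (by omega)
    · rw [habs]; exact hmid t h1 h2
    · rw [abs_mul, hs1, one_mul]; exact hxn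
    · rw [habs]; exact hall t ht
  have hX : σ * (⨆ k : Finset.Icc m n, -s * (√m / (k : ℕ)) * W k) =
      ⨆ k : Finset.Icc m n, -(s * (σ * (√m / (k : ℕ) * W k))) := by
    rw [Real.mul_iSup_of_nonneg hσ.le]
    congr 1
    ext k
    ring
  have hM : ∀ t : ℕ, |Y t - s * D * renyiDrift T n t| = |s * Y t - D * renyiDrift T n t| := by
    intro t
    rcases hs with rfl | rfl
    · simp
    · rw [← abs_neg]; congr 1; ring
  have hM' : (⨆ t : Finset.Icc m (T - m), |Y t - s * D * renyiDrift T n t|) =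
      ⨆ t : Finset.Icc m (T - m), |s * Y t - D * renyiDrift T n t| := iSup_congr fun t ↦ hM t
  have hfin := (key s hs).trans (le_of_eq (by ring : _ = (2 * σ + 20) * c))
  rwa [← hM', ← hX] at hfin

end Renyi

/-! ### Suprema over the inverted grid. -/

section Grid

/-- The maximum of a continuous function on `[0, 1]` is the limit of its maxima over the grids
`{m / k : m ≤ k ≤ n}`, as `m → ∞` and `n / m → ∞`. -/
lemma tendsto_iSup_grid {f : ℝ≥0 → ℝ} (hf : ContinuousOn f (Set.Icc 0 1)) {m n : ℕ → ℕ}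
    (hm : Tendsto m atTop atTop) (hn : Tendsto (fun T ↦ (n T : ℝ) / m T) atTop atTop) :
    Tendsto (fun T ↦ ⨆ k : Finset.Icc (m T) (n T), f ((m T : ℝ≥0) / ((k : ℕ) : ℝ≥0))) atTop
      (𝓝 (⨆ u : Set.Icc (0 : ℝ≥0) 1, f u)) := by
  obtain ⟨u, hu, hmax⟩ := isCompact_Icc.exists_isMaxOn (Set.nonempty_Icc.2 zero_le_one) hf
  have hle : ∀ v ∈ Set.Icc (0 : ℝ≥0) 1, f v ≤ f u := fun v hv ↦ hmax hv
  have hsup : (⨆ v : Set.Icc (0 : ℝ≥0) 1, f v) = f u := by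
    have : Nonempty (Set.Icc (0 : ℝ≥0) 1) := ⟨⟨u, hu⟩⟩
    exact le_antisymm (ciSup_le fun v ↦ hle v v.2)
      (le_ciSup (f := fun v : Set.Icc (0 : ℝ≥0) 1 ↦ f v)
        ⟨f u, by rintro _ ⟨v, rfl⟩; exact hle v v.2⟩ ⟨u, hu⟩)
  rw [hsup]
  have hmR : Tendsto (fun T ↦ (m T : ℝ)) atTop atTop := tendsto_natCast_atTop_atTop.comp hm
  obtain ⟨k, hk, hlim⟩ : ∃ k : ℕ → ℕ, (∀ᶠ T in atTop, k T ∈ Finset.Icc (m T) (n T)) ∧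
      Tendsto (fun T ↦ (m T : ℝ) / k T) atTop (𝓝 u) := by
    have hmn : ∀ a : ℝ, ∀ᶠ T in atTop, a * m T ≤ n T := by
      intro a
      filter_upwards [hn.eventually_ge_atTop a, hm.eventually_gt_atTop 0] with T h1 h2
      rwa [le_div_iff₀ (by exact_mod_cast h2)] at h1
    -- Grid points approaching the maximiser `u`: the last one, `m / n → 0`, if `u = 0`, and
    -- otherwise `k = ⌊m / u⌋`, which is at least `m` as `u ≤ 1` and eventually at most `n`.
    rcases eq_or_ne u 0 with rfl | hu0
    · refine ⟨n, ?_, ?_⟩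
      · filter_upwards [hmn 1] with T hT
        rw [one_mul] at hT
        exact Finset.mem_Icc.2 ⟨by exact_mod_cast hT, le_rfl⟩
      · simpa [Function.comp_def] using tendsto_inv_atTop_zero.comp hn
    · have hupos : (0 : ℝ) < u := by exact_mod_cast pos_of_ne_zero hu0
      have hu1 : (u : ℝ) ≤ 1 := by exact_mod_cast hu.2
      refine ⟨fun T ↦ ⌊(u : ℝ)⁻¹ * m T⌋₊, ?_, ?_⟩
      · filter_upwards [hmn (u : ℝ)⁻¹] with T hT
        refine Finset.mem_Icc.2 ⟨Nat.le_floor ?_, Nat.floor_le_of_le hT⟩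
        exact le_mul_of_one_le_left (by positivity) ((one_le_inv₀ hupos).2 hu1)
      · have h1 := ((tendsto_nat_floor_mul_div_atTop (inv_nonneg.2 hupos.le)).comp hmR).inv₀
          (inv_ne_zero hupos.ne')
        simpa [Function.comp_def] using h1
  have hmem : ∀ {a b : ℕ}, a ≤ b → ((a : ℝ≥0) / (b : ℝ≥0)) ∈ Set.Icc (0 : ℝ≥0) 1 := by
    intro a b hab
    exact ⟨zero_le, div_le_one_of_le₀ (by exact_mod_cast hab) zero_le⟩
  have hlim' : Tendsto (fun T ↦ (m T : ℝ≥0) / (k T : ℝ≥0)) atTop (𝓝[Set.Icc 0 1] u) := by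
    refine tendsto_nhdsWithin_iff.2 ⟨?_, ?_⟩
    · rw [← NNReal.tendsto_coe]
      simpa using hlim
    · filter_upwards [hk] with T hT
      exact hmem (Finset.mem_Icc.1 hT).1
  refine tendsto_of_tendsto_of_tendsto_of_le_of_le' ((hf u hu).tendsto.comp hlim')
    tendsto_const_nhds ?_ ?_
  · filter_upwards [hk] with T hT
    exact le_ciSup_Icc (fun j ↦ f ((m T : ℝ≥0) / (j : ℝ≥0))) hT
  · filter_upwards [hk] with T hT
    have : Nonempty (Finset.Icc (m T) (n T)) := ⟨⟨k T, hT⟩⟩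
    exact ciSup_le fun j ↦ hle _ (hmem (Finset.mem_Icc.1 j.2).1)

end Grid

/-! ### The statistics as noise minus signed drift. -/

section Observations

variable {Ω : Type*} {e : ℤ → Ω → ℝ}

/-- The sign of the change, chosen to be `1` or `-1`. -/
noncomputable def changeSign (μ : ℕ → ℕ → ℝ) (tstar : ℕ → ℕ) (T : ℕ) : ℝ :=
  if 0 ≤ changeSize μ tstar T then 1 else -1

lemma changeSign_eq (μ : ℕ → ℕ → ℝ) (tstar : ℕ → ℕ) (T : ℕ) :
    changeSign μ tstar T = 1 ∨ changeSign μ tstar T = -1 := by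
  rw [changeSign]; split_ifs <;> simp

lemma changeSign_mul_abs (μ : ℕ → ℕ → ℝ) (tstar : ℕ → ℕ) (T : ℕ) :
    changeSign μ tstar T * |changeSize μ tstar T| = changeSize μ tstar T := by
  rw [changeSign]
  split_ifs with h
  · rw [abs_of_nonneg h, one_mul]
  · rw [abs_of_neg (not_le.1 h)]; ring

lemma cusumStat_obs_eq {μ : ℕ → ℕ → ℝ} {tstar : ℕ → ℕ} {T : ℕ} (hT : 0 < T)
    (hn : tstar T ≤ T) (h1 : ∀ s, 1 ≤ s → s ≤ tstar T → μ T s = μ T (tstar T))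
    (h2 : ∀ s, tstar T + 1 ≤ s → s ≤ T → μ T s = μ T (tstar T + 1)) (ω : Ω) :
    cusumStat (obs μ e T ω) T = 1 / √(T : ℝ) * ⨆ t : Finset.Icc 1 T,
      |(partialSum e t ω - (t : ℕ) / T * partialSum e T ω) -
        changeSign μ tstar T * |changeSize μ tstar T| * cusumDrift T (tstar T) t| := by
  rw [cusumStat]
  congr 1
  refine iSup_congr fun ⟨t, ht⟩ ↦ ?_
  congr 1
  rw [changeSign_mul_abs]
  exact cusum_eq (f := μ T) (ε := fun s ↦ e (s : ℤ) ω) (fun s ↦ rfl) h1 h2 hn hT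
    (Finset.mem_Icc.1 ht).2

lemma renyiStat_obs_eq {μ : ℕ → ℕ → ℝ} {tstar : ℕ → ℕ} {T m : ℕ} (hm : 0 < m)
    (hn : tstar T ≤ T) (h1 : ∀ s, 1 ≤ s → s ≤ tstar T → μ T s = μ T (tstar T))
    (h2 : ∀ s, tstar T + 1 ≤ s → s ≤ T → μ T s = μ T (tstar T + 1)) (ω : Ω) :
    renyiStat (obs μ e T ω) T m = ⨆ t : Finset.Icc m (T - m),
      |(1 / ((t : ℕ) : ℝ) * partialSum e t ω - 1 / ((T : ℝ) - (t : ℕ)) *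
        (partialSum e T ω - partialSum e t ω)) -
        changeSign μ tstar T * |changeSize μ tstar T| * renyiDrift T (tstar T) t| := by
  rw [renyiStat]
  refine iSup_congr fun ⟨t, ht⟩ ↦ ?_
  obtain ⟨ht1, ht2⟩ := Finset.mem_Icc.1 ht
  congr 1
  rw [changeSign_mul_abs]
  exact renyi_eq (t := t) (f := μ T) (ε := fun s ↦ e (s : ℤ) ω) (fun s ↦ rfl) h1 h2 hn (by omega)
    (by omega)

end Observations

/-! ### The two limit theorems. -/

section Main

variable {Ω : Type*} [MeasurableSpace Ω] {P : Measure Ω} {e : ℤ → Ω → ℝ}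

lemma measurable_cusumStat_obs (he : ∀ t, Measurable (e t)) (μ : ℕ → ℕ → ℝ) (T : ℕ) :
    Measurable (fun ω ↦ cusumStat (obs μ e T ω) T) := by
  unfold cusumStat obs
  exact (Measurable.iSup fun t ↦ by fun_prop).const_mul _

lemma measurable_renyiStat_obs (he : ∀ t, Measurable (e t)) (μ : ℕ → ℕ → ℝ) (T m : ℕ) :
    Measurable (fun ω ↦ renyiStat (obs μ e T ω) T m) := by
  unfold renyiStat obs
  exact Measurable.iSup fun t ↦ by fun_prop

lemma eventually_four_mul_le {n : ℕ → ℕ}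
    (h : Tendsto (fun T : ℕ ↦ (n T : ℝ) / (T : ℝ)) atTop (𝓝 0)) :
    ∀ᶠ T in atTop, 4 * n T ≤ T := by
  filter_upwards [h.eventually_lt_const (show (0 : ℝ) < 1 / 4 by norm_num),
    eventually_gt_atTop 0] with T h1 h2
  rw [div_lt_iff₀ (by exact_mod_cast h2)] at h1
  have : 4 * (n T : ℝ) ≤ T := by linarith
  exact_mod_cast this

lemma tendsto_sqrt_div_atTop {n : ℕ → ℕ} (hn : ∀ᶠ T in atTop, 0 < n T)
    (h : Tendsto (fun T : ℕ ↦ (n T : ℝ) / (T : ℝ)) atTop (𝓝 0)) :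
    Tendsto (fun T : ℕ ↦ √(T : ℝ) / √(n T)) atTop atTop := by
  have h1 : Tendsto (fun T : ℕ ↦ ((n T : ℝ) / (T : ℝ))⁻¹) atTop atTop := by
    refine tendsto_inv_nhdsGT_zero.comp (tendsto_nhdsWithin_iff.2 ⟨h, ?_⟩)
    filter_upwards [hn, eventually_gt_atTop 0] with T h1 h2
    have h3 : (0 : ℝ) < n T := Nat.cast_pos.2 h1
    have h4 : (0 : ℝ) < T := Nat.cast_pos.2 h2
    exact div_pos h3 h4
  refine (Real.tendsto_sqrt_atTop.comp h1).congr fun T ↦ ?_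
  simp [Real.sqrt_div]

lemma mul_rpow_le_of_le {x κ r c : ℝ} (hx : 0 < x) (h : r ≤ c * x ^ (1 / 2 - κ)) :
    r * x ^ κ ≤ c * √x := by
  calc r * x ^ κ ≤ c * x ^ (1 / 2 - κ) * x ^ κ := by gcongr
    _ = c * √x := by rw [mul_assoc, ← Real.rpow_add hx, sub_add_cancel, Real.sqrt_eq_rpow]

lemma mul_le_mul_sqrt_of_le {x y r c : ℝ} (hx : 0 < x) (h : r ≤ c * (y / √x)) :
    r * √x ≤ c * y := by
  have hx' := Real.sqrt_pos.2 hx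
  calc r * √x ≤ c * (y / √x) * √x := by gcongr
    _ = c * y := by field_simp

/-- Asymptotic normality of the CUSUM statistic under an early change. -/
theorem tendstoInDistribution_cusumStat [IsProbabilityMeasure P]
    (he_meas : ∀ t, Measurable (e t)) {σ : ℝ} (he_approx : GaussianApprox P e σ)
    {μ : ℕ → ℕ → ℝ} {tstar : ℕ → ℕ} (hchange : OneChange μ tstar)
    (hearly : Tendsto (fun T : ℕ ↦ (tstar T : ℝ) / (T : ℝ)) atTop (𝓝 0))
    (htstar : Tendsto tstar atTop atTop)
    (hsize : Tendsto (fun T : ℕ ↦ |changeSize μ tstar T| * (tstar T : ℝ) ^ (3 / 2 : ℝ) / (T : ℝ))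
      atTop atTop) :
    TendstoInDistribution
      (fun (T : ℕ) (ω : Ω) ↦ √((T : ℝ) / (tstar T : ℝ)) * (cusumStat (obs μ e T ω) T
        - (T : ℝ) ^ (-(3 / 2) : ℝ) * (tstar T : ℝ) * ((T : ℝ) - (tstar T : ℝ))
          * |changeSize μ tstar T|))
      atTop (fun x : ℝ ↦ σ * x) (fun _ ↦ P) (gaussianReal 0 1) := by
  obtain ⟨hσ, κ, hκ0, hκ, W₁, W₂, hW, hhead, htail⟩ := he_approx
  have hW₁ := fun T ↦ (hW T).1
  have hW₂ := fun T ↦ (hW T).2.1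
  have hn4 := eventually_four_mul_le hearly
  have hn1 : ∀ᶠ T in atTop, 1 ≤ tstar T := htstar.eventually_ge_atTop 1
  set D : ℕ → ℝ := fun T ↦ |changeSize μ tstar T|
  have hδ : Tendsto (fun T ↦ D T * tstar T / T * √(tstar T)) atTop atTop := by
    refine hsize.congr' ?_
    filter_upwards [hn1] with T hT
    have h0 : (0 : ℝ) < tstar T := by exact_mod_cast hT
    rw [show (3 / 2 : ℝ) = 1 + 1 / 2 by norm_num, Real.rpow_add h0, Real.rpow_one,
      ← Real.sqrt_eq_rpow]
    ring
  -- One rate `r` serves for all `O_P(1)` terms. The three sequences make it negligible in `r √n`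
  -- against `√T`, in `r n ^ κ` against `√n`, and in `r ^ 2` against `δ √n`.
  obtain ⟨r, hr, hr'⟩ := exists_tendsto_atTop_le_mul
    (tendsto_sqrt_div_atTop (n := tstar) hn1 hearly)
    ((tendsto_rpow_atTop (by linarith : 0 < 1 / 2 - κ)).comp
      (tendsto_natCast_atTop_atTop.comp htstar)) (Real.tendsto_sqrt_atTop.comp hδ)
  refine tendstoInDistribution_of_eventually_identDistrib
    (X := fun T ω ↦ (-changeSign μ tstar T * σ / √(tstar T)) * W₁ T (tstar T) ω)
    (U := fun _ x ↦ σ * x) (P' := gaussianReal 0 1)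
    (fun T ↦ (((measurable_cusumStat_obs he_meas μ T).sub_const _).const_mul _).aemeasurable)
    (tendstoInDistribution_const (by fun_prop)) ?_ fun c₀ hc₀ ↦ ?_
  · filter_upwards [hn4, hn1] with T h4 h1
    have h0 : (0 : ℝ) < tstar T := by exact_mod_cast h1
    have e1 := gaussianReal_const_mul ((hW₁ T).hasLaw_eval (natCast_le_half (k := tstar T)
      (by omega))) (-changeSign μ tstar T * σ / √(tstar T))
    have e2 := gaussianReal_const_mul (HasLaw.id (μ := gaussianReal 0 1)) σ
    refine ⟨e1.aemeasurable, e2.aemeasurable, ?_⟩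
    rw [e1.map_eq]
    refine Eq.trans ?_ e2.map_eq.symm
    congr 1
    · simp
    · ext
      have : changeSign μ tstar T ^ 2 = 1 := by
        rcases changeSign_eq μ tstar T with h | h <;> rw [h] <;> norm_num
      push_cast
      rw [div_pow, mul_pow, neg_sq, this, Real.sq_sqrt h0.le]
      field_simp
  · set c : ℝ := c₀ / (σ + 9)
    have hc : 0 < c := by positivity
    have hincr := whp_abs_increment_le_line hW₁ (n := tstar)
      (hn4.mono fun T hT ↦ by omega) (a := fun T ↦ c * √(tstar T))
      (δ := fun T ↦ D T * tstar T / T / (4 * σ)) (.of_forall fun T ↦ by positivity)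
      ((hδ.const_mul_atTop (show 0 < c / (4 * σ) by positivity)).congr fun T ↦ by ring)
    have hWn := whp_abs_wiener_le_mul_sqrt hW₁ (u := fun T ↦ (tstar T : ℝ≥0))
      (by filter_upwards [hn4, hn1] with T h4 h1
          exact ⟨by exact_mod_cast h1, natCast_le_half (by omega)⟩) hr
    refine ((hhead.whp hr).and (hincr.and (hWn.and
      (whp_abs_partialSum_le hσ hκ.le hW₁ hW₂ hhead htail hr)))).mono ?_
    filter_upwards [hn4, hn1, hchange, hr.eventually_ge_atTop 0, hδ.eventually_ge_atTop 1,
      hr' c hc, hr' (√c) (by positivity), hr' (1 / (32 * (σ + 1))) (by positivity)] with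
      T h4 h1 ⟨_, hTn, hμ1, hμ2, _⟩ hr0 hδ1 hc1 hc2 hc3 ω ⟨E1, E2, E3, E4⟩
    have hn0 : (0 : ℝ) < tstar T := by exact_mod_cast h1
    have hT : 0 < T := by omega
    have hT0 : (0 : ℝ) < T := by exact_mod_cast hT
    have hsn : 0 < √(tstar T : ℝ) := Real.sqrt_pos.2 hn0
    have hsT : 0 < √(T : ℝ) := Real.sqrt_pos.2 hT0
    have hsqn : √(tstar T : ℝ) * √(tstar T) = tstar T := Real.mul_self_sqrt hn0.le
    have hle : √(tstar T : ℝ) ≤ √T := Real.sqrt_le_sqrt (by exact_mod_cast hTn.le)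
    have hD0 : 0 ≤ D T * tstar T / T := by positivity
    simp only [Function.comp_apply] at hc1 hc2 hc3
    have hmain := abs_iSup_cusum_le (S := fun t ↦ partialSum e t ω)
      (W := fun t ↦ W₁ T (t : ℝ≥0) ω) hσ hκ0.le hκ.le hr0 hc.le (abs_nonneg _ : 0 ≤ D T)
      (changeSign_eq μ tstar T) h1 h4 (fun t => abs_partialSum_sub_le E1 hr0) E2.1 E2.2
      (by simpa using E3) E4 (mul_rpow_le_of_le hn0 hc1.2.1) ?_ ?_ ?_
    · have e1 := cusumStat_obs_eq (e := e) hT hTn.le hμ1 hμ2 ω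
      rw [e1]
      set M : ℝ := ⨆ t : Finset.Icc 1 T,
        |(partialSum e t ω - (t : ℕ) / T * partialSum e T ω) -
          changeSign μ tstar T * |changeSize μ tstar T| * cusumDrift T (tstar T) t|
      -- The centring is `D` times the peak of the drift over `√T`, because `n * (T - n) / T = n - n
      -- ^ 2 / T`.
      have e2 : √((T : ℝ) / tstar T) * (1 / √(T : ℝ) * M - (T : ℝ) ^ (-(3 / 2) : ℝ) * tstar T *
          (T - tstar T) * D T) - (-changeSign μ tstar T * σ / √(tstar T)) * W₁ T (tstar T) ω =
          1 / √(tstar T) * (M - D T * cusumDrift T (tstar T) (tstar T) +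
            changeSign μ tstar T * (σ * W₁ T (tstar T) ω)) := by
        rw [Real.rpow_neg hT0.le, show (3 / 2 : ℝ) = 1 + 1 / 2 by norm_num, Real.rpow_add hT0,
          Real.rpow_one, ← Real.sqrt_eq_rpow, Real.sqrt_div hT0.le, cusumDrift_self]
        field_simp
        ring
      change |√((T : ℝ) / tstar T) * (1 / √(T : ℝ) * M - (T : ℝ) ^ (-(3 / 2) : ℝ) * tstar T *
          (T - tstar T) * D T) - (-changeSign μ tstar T * σ / √(tstar T)) * W₁ T (tstar T) ω| ≤ c₀
      rw [e2, abs_mul, abs_of_pos (by positivity), one_div, inv_mul_le_iff₀ hsn]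
      refine hmain.trans (le_of_eq ?_)
      simp only [c]
      field_simp
    · rw [div_le_iff₀ hsT]
      have := mul_le_mul_sqrt_of_le hn0 hc1.1
      calc r T * tstar T = (r T * √(tstar T)) * √(tstar T) := by rw [mul_assoc, hsqn]
        _ ≤ (c * √T) * √(tstar T) := by gcongr
        _ = c * √(tstar T) * √T := by ring
    · calc r T ^ 2 ≤ (√c * √(D T * tstar T / T * √(tstar T))) ^ 2 := by
            gcongr; exact hc2.2.2
        _ = c * (D T * tstar T / T * √(tstar T)) := by
            rw [mul_pow, Real.sq_sqrt hc.le, Real.sq_sqrt (by positivity)]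
    · have e1 := hc3.2.2
      rw [one_div, ← div_eq_inv_mul, le_div_iff₀ (by positivity)] at e1
      -- The square root is dropped because its argument is eventually at least one.
      have e2 : √(D T * tstar T / T * √(tstar T)) ≤ D T * tstar T / T * √(tstar T) :=
        Real.sqrt_le_iff.2 ⟨by positivity, by nlinarith⟩
      have e3 : D T * tstar T / T * √(tstar T) ≤ D T * tstar T / T * √T := by gcongr
      linarith

/-- Time inversion: the weighted Wiener process on a grid has the law of a Wiener process on the
inverted grid. -/
lemma identDistrib_iSup_grid {a : ℝ≥0} {W : ℝ≥0 → Ω → ℝ} (hW : IsWienerOn P a W) {Ω' : Type*}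
    [MeasurableSpace Ω'] {P' : Measure Ω'} {W' : ℝ≥0 → Ω' → ℝ} (hW' : IsWienerOn P' 1 W')
    {m n : ℕ} (hm : 1 ≤ m) (hn : (n : ℝ≥0) ≤ a) {s : ℝ} (hs : s = 1 ∨ s = -1) (σ : ℝ) :
    IdentDistrib (fun ω ↦ σ * ⨆ k : Finset.Icc m n, -s * (√m / (k : ℕ)) * W (k : ℕ) ω)
      (fun ω ↦ σ * ⨆ k : Finset.Icc m n, W' ((m : ℝ≥0) / ((k : ℕ) : ℝ≥0)) ω) P P' := by
  have hm0 : (0 : ℝ) < m := by exact_mod_cast hm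
  have hk1 (k : Finset.Icc m n) : ((k : ℕ) : ℝ≥0) ≤ a :=
    le_trans (by exact_mod_cast (Finset.mem_Icc.1 k.2).2) hn
  have hk2 (k : Finset.Icc m n) : (m : ℝ≥0) / ((k : ℕ) : ℝ≥0) ≤ 1 :=
    div_le_one_of_le₀ (by exact_mod_cast (Finset.mem_Icc.1 k.2).1) zero_le
  have hk0 (k : Finset.Icc m n) : (0 : ℝ) < (k : ℕ) := by
    exact_mod_cast hm.trans (Finset.mem_Icc.1 k.2).1
  have hG := hW.hasGaussianLaw (fun k : Finset.Icc m n ↦ ((k : ℕ) : ℝ≥0)) hk1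
  have hid := identDistrib_of_covariance_eq
    (X := fun (k : Finset.Icc m n) ω ↦ -s * (√m / (k : ℕ)) * W (k : ℕ) ω)
    (Y := fun (k : Finset.Icc m n) ω ↦ W' ((m : ℝ≥0) / ((k : ℕ) : ℝ≥0)) ω)
    (hG.map_fun (ContinuousLinearMap.pi fun k : Finset.Icc m n ↦
      (-s * (√m / ((k : ℕ) : ℝ))) •
        ContinuousLinearMap.proj (R := ℝ) (φ := fun _ : Finset.Icc m n ↦ ℝ) k))
    (hW'.hasGaussianLaw (fun k : Finset.Icc m n ↦ (m : ℝ≥0) / ((k : ℕ) : ℝ≥0)) hk2)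
    (fun k ↦ by rw [integral_const_mul, hW.integral_eval (hk1 k), mul_zero])
    (fun k ↦ hW'.integral_eval (hk2 k)) fun j k ↦ ?_
  · refine hid.comp (u := fun y : Finset.Icc m n → ℝ ↦ σ * ⨆ k, y k) ?_
    exact (Measurable.iSup fun k ↦ measurable_pi_apply k).const_mul _
  · have hs2 : s * s = 1 := by rcases hs with rfl | rfl <;> norm_num
    rw [covariance_const_mul_left, covariance_const_mul_right]
    have e1 := hW.covariance_eval (hk1 j) (hk1 k)
    have e2 := hW'.covariance_eval (hk2 j) (hk2 k)
    change -s * (√m / (j : ℕ)) * (-s * (√m / (k : ℕ)) * cov[W (j : ℕ), W (k : ℕ); P]) =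
      cov[W' ((m : ℝ≥0) / ((j : ℕ) : ℝ≥0)), W' ((m : ℝ≥0) / ((k : ℕ) : ℝ≥0)); P']
    rw [e1, e2]
    have hj := hk0 j
    have hk := hk0 k
    have hsqm : √(m : ℝ) * √m = m := Real.mul_self_sqrt hm0.le
    -- Time inversion in terms of covariances: `m / (j k) * min j k = min (m / j) (m / k)`.
    have e3 : ∀ x : ℝ, -s * (√m / (j : ℕ)) * (-s * (√m / (k : ℕ)) * x) =
        m / ((j : ℕ) * (k : ℕ)) * x := by
      intro x
      calc _ = (s * s) * (√m * √m) / ((j : ℕ) * (k : ℕ)) * x := by ring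
        _ = _ := by rw [hs2, hsqm, one_mul]
    rw [e3]
    push_cast
    rcases le_total ((j : ℕ) : ℝ) (k : ℕ) with h | h
    · rw [min_eq_left h, min_eq_right (by gcongr)]
      field_simp
    · rw [min_eq_right h, min_eq_left (by gcongr)]
      field_simp

/-- Limit law of the Rényi statistic under an early change. -/
theorem tendstoInDistribution_renyiStat [IsProbabilityMeasure P]
    (he_meas : ∀ t, Measurable (e t)) {σ : ℝ} (he_approx : GaussianApprox P e σ)
    {μ : ℕ → ℕ → ℝ} {tstar : ℕ → ℕ} (hchange : OneChange μ tstar)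
    (hearly : Tendsto (fun T : ℕ ↦ (tstar T : ℝ) / (T : ℝ)) atTop (𝓝 0)) {m : ℕ → ℕ}
    (hm : Tendsto m atTop atTop) (hmT : Tendsto (fun T : ℕ ↦ (m T : ℝ) / (T : ℝ)) atTop (𝓝 0))
    (hnm : Tendsto (fun T : ℕ ↦ (tstar T : ℝ) / (m T : ℝ)) atTop atTop)
    (hsmall : Tendsto (fun T : ℕ ↦ √(m T : ℝ) * (tstar T : ℝ) * |changeSize μ tstar T| / (T : ℝ))
      atTop (𝓝 0))
    (hlarge : Tendsto (fun T : ℕ ↦ √(m T : ℝ) * |changeSize μ tstar T|) atTop atTop)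
    {Ω' : Type*} [MeasurableSpace Ω'] {P' : Measure Ω'} [IsProbabilityMeasure P']
    {W : ℝ≥0 → Ω' → ℝ} (hWiener : IsWienerOn P' 1 W) :
    TendstoInDistribution
      (fun (T : ℕ) (ω : Ω) ↦ √(m T : ℝ) *
        (renyiStat (obs μ e T ω) T (m T) - |changeSize μ tstar T|))
      atTop (fun ω ↦ σ * ⨆ u : Set.Icc (0 : ℝ≥0) 1, W u ω) (fun _ ↦ P) P' := by
  obtain ⟨hσ, κ, hκ0, hκ, W₁, W₂, hW, hhead, htail⟩ := he_approx
  have hW₁ := fun T ↦ (hW T).1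
  have hW₂ := fun T ↦ (hW T).2.1
  have hn4 := eventually_four_mul_le hearly
  have hm1 : ∀ᶠ T in atTop, 1 ≤ m T := hm.eventually_ge_atTop 1
  have hmn : ∀ᶠ T in atTop, m T ≤ tstar T := by
    filter_upwards [hnm.eventually_ge_atTop 1, hm1] with T h1 h2
    rw [le_div_iff₀ (by exact_mod_cast h2), one_mul] at h1
    exact_mod_cast h1
  set D : ℕ → ℝ := fun T ↦ |changeSize μ tstar T|
  have hUm : ∀ T, AEMeasurable (fun ω ↦ σ * ⨆ k : Finset.Icc (m T) (tstar T),
      W ((m T : ℝ≥0) / ((k : ℕ) : ℝ≥0)) ω) P' := by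
    intro T
    refine AEMeasurable.const_mul (AEMeasurable.iSup fun k ↦ ?_) _
    exact (hWiener.hasGaussianLaw_eval (div_le_one_of_le₀
      (by exact_mod_cast (Finset.mem_Icc.1 k.2).1) zero_le)).aemeasurable
  have hUlim : ∀ᵐ ω ∂P', Tendsto (fun T ↦ σ * ⨆ k : Finset.Icc (m T) (tstar T),
      W ((m T : ℝ≥0) / ((k : ℕ) : ℝ≥0)) ω) atTop
      (𝓝 (σ * ⨆ u : Set.Icc (0 : ℝ≥0) 1, W u ω)) := by
    filter_upwards [hWiener.continuousOn] with ω hω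
    exact (tendsto_iSup_grid hω hm hnm).const_mul σ
  -- Here `r` must be negligible in `r √m` against `√T`, in `r m ^ κ` against `√m`, and against `√m
  -- * D`.
  obtain ⟨r, hr, hr'⟩ := exists_tendsto_atTop_le_mul
    (tendsto_sqrt_div_atTop (n := m) hm1 hmT)
    ((tendsto_rpow_atTop (by linarith : 0 < 1 / 2 - κ)).comp
      (tendsto_natCast_atTop_atTop.comp hm)) hlarge
  refine tendstoInDistribution_of_eventually_identDistrib
    (X := fun T ω ↦ σ * ⨆ k : Finset.Icc (m T) (tstar T),
      -changeSign μ tstar T * (√(m T) / (k : ℕ)) * W₁ T (k : ℕ) ω)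
    (fun T ↦ (((measurable_renyiStat_obs he_meas μ T _).sub_const _).const_mul _).aemeasurable)
    (tendstoInDistribution_of_ae_tendsto hUm (aemeasurable_of_tendsto_metrizable_ae _ hUm hUlim)
      hUlim) ?_ fun c₀ hc₀ ↦ ?_
  · filter_upwards [hn4, hm1] with T h4 h1
    exact identDistrib_iSup_grid (hW₁ T) hWiener h1 (natCast_le_half (by omega))
      (changeSign_eq μ tstar T) σ
  · set c : ℝ := c₀ / (2 * σ + 20)
    have hc : 0 < c := by positivity
    -- For `k ≥ l` a line with intercept proportional to `l` lies below a line through the origin.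
    -- The crossing exponent is of order `b ^ 2 * l / m`: it diverges for `l = m` with `b = r`, and
    -- for `l = n` with the constant `b = c`.
    have hline {W : ℕ → ℝ≥0 → Ω → ℝ} (hW : ∀ T : ℕ, IsWienerOn P ((T : ℝ≥0) / 2) (W T))
        {b : ℕ → ℝ} {l : ℕ → ℕ} (hb : ∀ᶠ T in atTop, 0 ≤ b T)
        (hl : Tendsto (fun T ↦ b T ^ 2 * (l T / m T : ℝ)) atTop atTop) :
        WHP P (fun T ω ↦ ∀ k : ℕ, l T ≤ k → 2 * k ≤ T → √(m T) * |W T k ω| ≤ b T * k) := by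
      have h1 := whp_abs_wiener_le_line hW (a := fun T ↦ b T * l T / (2 * √(m T)))
        (δ := fun T ↦ b T / (2 * √(m T))) (hb.mono fun T hT ↦ by positivity) ?_
      · refine h1.mono ?_
        filter_upwards [hm1, hb] with T h1 h2 ω hω k hk hkT
        have hm0 : (0 : ℝ) < m T := by exact_mod_cast h1
        have hsm : 0 < √(m T : ℝ) := Real.sqrt_pos.2 hm0
        have hk' : (l T : ℝ) ≤ k := by exact_mod_cast hk
        calc √(m T) * |W T k ω| ≤
            √(m T) * (b T * l T / (2 * √(m T)) + b T / (2 * √(m T)) * k) := by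
              gcongr; exact hω k hkT
          _ = b T * l T / 2 + b T * k / 2 := by field_simp
          _ ≤ b T * k / 2 + b T * k / 2 := by gcongr
          _ = b T * k := by ring
      · refine (hl.const_mul_atTop (show (0 : ℝ) < 1 / 4 by norm_num)).congr' ?_
        filter_upwards [hm1] with T h1
        have hm0 : (0 : ℝ) < m T := by exact_mod_cast h1
        have hsqm : √(m T : ℝ) ^ 2 = m T := Real.sq_sqrt hm0.le
        have hsm : 0 < √(m T : ℝ) := Real.sqrt_pos.2 hm0
        calc 1 / 4 * (b T ^ 2 * (l T / m T : ℝ)) = 1 / 4 * (b T ^ 2 * (l T / √(m T) ^ 2)) := by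
              rw [hsqm]
          _ = _ := by field_simp; ring
    have hrm : Tendsto (fun T ↦ r T ^ 2 * (m T / m T : ℝ)) atTop atTop := by
      refine ((tendsto_pow_atTop two_ne_zero).comp hr).congr' ?_
      filter_upwards [hm1] with T h1
      have hm0 : (0 : ℝ) < m T := by exact_mod_cast h1
      simp [hm0.ne']
    have hr0 := hr.eventually_ge_atTop 0
    refine ((hhead.whp hr).and ((htail.whp hr).and ((hline hW₁ hr0 hrm).and
      ((hline hW₂ hr0 hrm).and ((hline hW₁ (b := fun _ ↦ c) (.of_forall fun _ ↦ hc.le)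
        (hnm.const_mul_atTop (by positivity))).and
      (whp_abs_partialSum_le hσ hκ.le hW₁ hW₂ hhead htail hr)))))).mono ?_
    filter_upwards [hn4, hm1, hmn, hchange, hr0, hr' c hc, hr' (1 / (4 * σ)) (by positivity),
      hlarge.eventually_ge_atTop (2 * ((4 * σ + 20) * c)), hsmall.eventually_le_const hc] with
      T h4 h1 hmn ⟨_, hTn, hμ1, hμ2, _⟩ hr0 hc1 hc2 hc3 hc4 ω ⟨E1, E2, E3, E4, E5, E6⟩
    have hm0 : (0 : ℝ) < m T := by exact_mod_cast h1
    have hmain := abs_iSup_renyi_le (S := fun t ↦ partialSum e t ω)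
      (W := fun t ↦ W₁ T (t : ℝ≥0) ω) (V := fun t ↦ W₂ T (t : ℝ≥0) ω) hσ hκ.le hc.le
      (abs_nonneg _ : 0 ≤ D T) (changeSign_eq μ tstar T) h1 hmn h4
      (fun t => abs_partialSum_sub_le E1 hr0) (fun k => abs_tail_sub_le_natCast E2 hr0) E3 E4 E5 E6
      (mul_rpow_le_of_le hm0 hc1.2.1) (mul_le_mul_sqrt_of_le hm0 hc1.1) hc4 ?_
    · rw [renyiStat_obs_eq (e := e) (by omega) hTn.le hμ1 hμ2 ω]
      refine hmain.trans (le_of_eq ?_)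
      simp only [c]
      field_simp
    · have e1 := hc2.2.2
      rw [one_div, ← div_eq_inv_mul, le_div_iff₀ (by positivity)] at e1
      change 2 * ((4 * σ + 20) * c) ≤ √(m T) * D T at hc3
      change r T * (4 * σ) ≤ √(m T) * D T at e1
      linarith

end Main

end RenyiCP

theorem theorem4p2 {Ω : Type*} [MeasurableSpace Ω] (P : Measure Ω) [IsProbabilityMeasure P]
    (e : ℤ → Ω → ℝ) (he_meas : ∀ t, Measurable (e t))
    (he_mean : ∀ t, Integrable (e t) P ∧ ∫ ω, e t ω ∂P = 0)
    (σ : ℝ) (he_approx : RenyiCP.GaussianApprox P e σ)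
    (μ : ℕ → ℕ → ℝ) (tstar : ℕ → ℕ) (hchange : RenyiCP.OneChange μ tstar)
    (hearly : Tendsto (fun T : ℕ ↦ (tstar T : ℝ) / (T : ℝ)) atTop (𝓝 0)) :
    -- (i)
    (RenyiCP.IsStationary P e → RenyiCP.MomentBound P e →
      Tendsto tstar atTop atTop →
      Tendsto (fun T : ℕ ↦ |RenyiCP.changeSize μ tstar T| * (tstar T : ℝ) ^ (3 / 2 : ℝ) / (T : ℝ))
        atTop atTop →
      TendstoInDistribution
        (fun (T : ℕ) (ω : Ω) ↦ √((T : ℝ) / (tstar T : ℝ)) *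
          (RenyiCP.cusumStat (RenyiCP.obs μ e T ω) T
            - (T : ℝ) ^ (-(3 / 2) : ℝ) * (tstar T : ℝ) * ((T : ℝ) - (tstar T : ℝ))
              * |RenyiCP.changeSize μ tstar T|))
        atTop (fun x : ℝ ↦ σ * x) (fun _ ↦ P) (gaussianReal 0 1)) ∧
    -- (ii)
    (∀ tT : ℕ → ℕ,
      Tendsto tT atTop atTop →
      Tendsto (fun T : ℕ ↦ (tT T : ℝ) / (T : ℝ)) atTop (𝓝 0) →
      Tendsto (fun T : ℕ ↦ (tstar T : ℝ) / (tT T : ℝ)) atTop atTop →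
      Tendsto (fun T : ℕ ↦ √(tT T : ℝ) * (tstar T : ℝ) * |RenyiCP.changeSize μ tstar T| / (T : ℝ))
        atTop (𝓝 0) →
      Tendsto (fun T : ℕ ↦ √(tT T : ℝ) * |RenyiCP.changeSize μ tstar T|) atTop atTop →
      ∀ (Ω' : Type*) [MeasurableSpace Ω'] (P' : Measure Ω') [IsProbabilityMeasure P']
        (W : ℝ≥0 → Ω' → ℝ), RenyiCP.IsWienerOn P' 1 W →
      TendstoInDistribution
        (fun (T : ℕ) (ω : Ω) ↦ √(tT T : ℝ) *
          (RenyiCP.renyiStat (RenyiCP.obs μ e T ω) T (tT T) - |RenyiCP.changeSize μ tstar T|))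
        atTop (fun ω ↦ σ * ⨆ u : Set.Icc (0 : ℝ≥0) 1, W u ω) (fun _ ↦ P) P') := by
  exact ⟨fun _ _ htstar hsize ↦
      RenyiCP.tendstoInDistribution_cusumStat he_meas he_approx hchange hearly htstar hsize,
    fun _ hm hmT hnm hsmall hlarge _ _ _ _ _ hW ↦
      RenyiCP.tendstoInDistribution_renyiStat he_meas he_approx hchange hearly hm hmT hnm hsmall
        hlarge hW⟩
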